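/- Consider a slotted-time system with a primary user (PU), a secondary user (SU) and a common destination. There are three infinite-capacity first-in-first-out queues: $Q_p$ (packets of the PU), $Q_{sp}$ (packets of the PU relayed by the SU) and $Q_s$ (own packets of the SU). Packets arrive at $Q_p$ and $Q_s$ as independent Bernoulli processes with rates $\lambda_p,\lambda_s\in[0,1]$ packets per slot; an arrival joins its queue at the end of its slot. A transmission takes one slot; it succeeds with probability $f_{pd}$ from PU to destination, $f_{ps}$ from PU to SU and $f_{sd}$ from SU to destination. In a slot at whose beginning $Q_p$ is non-empty, the PU transmits the head of $Q_p$: if the destination decodes the packet, it leaves the system; if the destination does not decode it but the SU does, then with probability $p_a$ it is moved to $Q_{sp}$; in all other cases it stays in $Q_p$. In a slot at whose beginning $Q_p$ is empty, the SU selects $Q_s$ with probability $p_q$ or $Q_{sp}$ with probability $1-p_q$ and transmits the head of the selected queue, if there is one; the packet leaves the system if the destination decodes it and stays otherwise. All arrivals, channel outcomes, admission decisions and queue selections are mutually independent, within and across slots, and the numbers of packets initially present in the three queues are arbitrary. All the rates and probabilities lie in $[0,1]$. Write $r=p_af_{ps}(1-f_{pd})$ and $\mu_p=f_{pd}+r$,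 and assume that $(\lambda_p,\lambda_s)$ lies in the stable throughput region $$\lambda_s<p_qf_{sd}\Big[1-\frac{\lambda_p}{\mu_p}\Big],\qquad \lambda_p<\frac{f_{sd}(1-p_q)\,\mu_p}{f_{sd}(1-p_q)+r}.$$ Then the average lengths $N_k=\lim_{t\to\infty}\mathbf E[Q_k^t]$ of the queues $k\in\{p,sp,s\}$, where $Q_k^t$ is the length at the beginning of slot $t$, exist and are $$N_p=\frac{-\lambda_p^2+\lambda_p}{\mu_p-\lambda_p},\qquad N_{sp}=\frac{m\lambda_p^2+n\lambda_p}{\alpha\lambda_p^2+\beta\lambda_p+\gamma},\qquad N_s=\frac{\lambda_p\lambda_sA+(\lambda_s^2-\lambda_s)B(B+\lambda_p)}{BC},$$ where $$m=r\Big[\frac{(1-p_q)f_{sd}-f_{pd}}{\mu_p}-(1-p_q)f_{sd}-r\Big],\quad n=r\mu_p,\quad \alpha=(1-p_q)f_{sd}+r,$$ $$\beta=\mu_p\big[-2(1-p_q)f_{sd}-r\big],\quad \gamma=(1-p_q)f_{sd}\,\mu_p^2,$$ $$A=p_qf_{sd}(\mu_p-1),\quad B=\mu_p-\lambda_p,\quad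 C=(\lambda_s-p_qf_{sd})\mu_p+p_qf_{sd}\lambda_p.$$ Call delay of a packet that arrives in slot $a$ and is delivered to the destination in slot $d$ the number $d-a$ of slots that it spends in the system. If $\lambda_p>0$, then almost surely every arriving PU packet is delivered and the long-run average delay of the PU packets (the average over all the packets arriving in the first $T$ slots, as $T\to\infty$) exists and equals $$D_p=\frac{N_p+N_{sp}}{\lambda_p};$$ if $\lambda_s>0$, then almost surely the same holds for the SU packets, with long-run average delay $$D_s=\frac{N_s}{\lambda_s}.$$ -/

import Mathlib

open MeasureTheory ProbabilityTheory Filter Topology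

namespace CogRelay

/-- The seven binary random inputs of a time slot: the arrivals at the primary user (PU) and at the
secondary user (SU), the success of the channels PU to destination, PU to SU and SU to destination,
the admission decision of the relay queue, and the queue selection of the SU
(`true`: its own queue, `false`: the relay queue). -/
inductive Input
  | arrP
  | arrS
  | chPD
  | chPS
  | chSD
  | accept
  | select

/-- The parameters: arrival rates `lamP`, `lamS`, channel success probabilities `fpd`, `fps`, `fsd`,
admission probability `pa` and queue selection probability `pq`. -/
structure Params where
  lamP : ℝ
  lamS : ℝ
  fpd : ℝ
  fps : ℝ
  fsd : ℝ
  pa : ℝ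
  pq : ℝ

/-- The probability that an input bit is `true`. -/
def Params.prob (p : Params) : Input → ℝ
  | .arrP => p.lamP
  | .arrS => p.lamS
  | .chPD => p.fpd
  | .chPS => p.fps
  | .chSD => p.fsd
  | .accept => p.pa
  | .select => p.pq

/-! ### The queueing system -/

/-- A packet: `some a` is the packet that arrived in slot `a` (each user has at most one arrival per
slot), `none` is a packet that was present initially. -/
abbrev Packet := Option ℕ

/-- The contents of the three queues at the beginning of a slot, oldest packet first:
the PU's queue, the relay queue of the SU, and the SU's queue of own packets. -/
structure State where
  qP : List Packet
  qSP : List Packet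
  qS : List Packet

/-- The transmission in a slot. A busy PU transmits the head of its queue: the packet leaves
the system if the destination decodes it; otherwise it moves to the relay queue if the SU decodes and
admits it; otherwise it stays. If the PU is idle, the SU transmits the head (if any) of the selected
queue, and the packet leaves the system if the destination decodes it. -/
def State.transmit (s : State) (u : Input → Bool) : State :=
  match s.qP with
  | x :: rest =>
    if u .chPD then { s with qP := rest }
    else if u .chPS && u .accept then { s with qP := rest, qSP := s.qSP ++ [x] }
    else s
  | [] =>
    if u .chSD then
      if u .select then { s with qS := s.qS.tail } else { s with qSP := s.qSP.tail }
    else s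

/-- The arrivals of slot `t`, which join the queues after the transmission of that slot. -/
def State.arrive (s : State) (t : ℕ) (u : Input → Bool) : State where
  qP := if u .arrP then s.qP ++ [some t] else s.qP
  qSP := s.qSP
  qS := if u .arrS then s.qS ++ [some t] else s.qS

/-- The state with the given numbers of packets initially present in the three queues. -/
def initial (nP nSP nS : ℕ) : State where
  qP := List.replicate nP none
  qSP := List.replicate nSP none
  qS := List.replicate nS none

/-- The state at the beginning of slot `t`, when `u i` is the input of slot `i`. -/
def run (s₀ : State) (u : ℕ → Input → Bool) : ℕ → State
  | 0 => s₀
  | t + 1 => ((run s₀ u t).transmit (u t)).arrive t (u t)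

/-- The delay of the PU packet that arrives in slot `a`: the number of slots at whose beginning it is
in the system, in the PU's queue or in the relay queue. (If it is delivered in slot `d`, these are the
slots `a + 1, …, d`.) It is `⊤` for a packet that is never delivered. -/
noncomputable def delayP (s₀ : State) (u : ℕ → Input → Bool) (a : ℕ) : ℕ∞ :=
  Set.encard {t : ℕ | some a ∈ (run s₀ u t).qP ∨ some a ∈ (run s₀ u t).qSP}

/-- The delay of the SU packet that arrives in slot `a`. -/
noncomputable def delayS (s₀ : State) (u : ℕ → Input → Bool) (a : ℕ) : ℕ∞ :=
  Set.encard {t : ℕ | some a ∈ (run s₀ u t).qS}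

/-- `D` is the average delay of the packets: packets arrive in the slots `a` with `arr a = true`, the
packet of slot `a` has the finite delay `delay a`, and the delay averaged over all the packets that
arrive in the first `T` slots tends to `D` as `T → ∞`. -/
def HasAverageDelay (arr : ℕ → Bool) (delay : ℕ → ℕ∞) (D : ℝ) : Prop :=
  (∀ a, arr a = true → delay a ≠ ⊤) ∧
  Tendsto (fun T : ℕ =>
    (∑ a ∈ (Finset.range T).filter (fun a => arr a = true), ((delay a).toNat : ℝ)) /
      (((Finset.range T).filter (fun a => arr a = true)).card : ℝ)) atTop (𝓝 D)

/-- `N` is the (steady-state) average of the queue length `L t`: all the `L t` are integrable and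
their expectations tend to `N` as `t → ∞`. -/
def HasAverageLength {Ω : Type*} [MeasurableSpace Ω] (P : Measure Ω) (L : ℕ → Ω → ℕ) (N : ℝ) :
    Prop :=
  (∀ t, Integrable (fun ω => (L t ω : ℝ)) P) ∧
  Tendsto (fun t => ∫ ω, (L t ω : ℝ) ∂P) atTop (𝓝 N)

/-! ### The explicit formulas -/

namespace Params

variable (p : Params)

/-- Probability that a PU transmission moves the packet to the relay queue. -/
noncomputable def r : ℝ := p.pa * p.fps * (1 - p.fpd)

/-- Service rate of the PU's queue. -/
noncomputable def μ : ℝ := p.fpd + p.r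

/-- The stable throughput region for the given `(pq, pa)`. -/
def Stable : Prop :=
  p.lamS < p.pq * p.fsd * (1 - p.lamP / p.μ) ∧
  p.lamP < p.fsd * (1 - p.pq) * p.μ / (p.fsd * (1 - p.pq) + p.r)

/-- The average length of the PU's queue. -/
noncomputable def Np : ℝ := (-p.lamP ^ 2 + p.lamP) / (p.μ - p.lamP)

noncomputable def m : ℝ :=
  p.r * (((1 - p.pq) * p.fsd - p.fpd) / p.μ - (1 - p.pq) * p.fsd - p.r)

noncomputable def n : ℝ := p.r * p.μ

noncomputable def α : ℝ := (1 - p.pq) * p.fsd + p.r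

noncomputable def β : ℝ := p.μ * (-2 * (1 - p.pq) * p.fsd - p.r)

noncomputable def γ : ℝ := (1 - p.pq) * p.fsd * p.μ ^ 2

/-- The average length of the relay queue. -/
noncomputable def Nsp : ℝ :=
  (p.m * p.lamP ^ 2 + p.n * p.lamP) / (p.α * p.lamP ^ 2 + p.β * p.lamP + p.γ)

noncomputable def A : ℝ := p.pq * p.fsd * (p.μ - 1)

noncomputable def B : ℝ := p.μ - p.lamP

noncomputable def C : ℝ := (p.lamS - p.pq * p.fsd) * p.μ + p.pq * p.fsd * p.lamP

/-- The average length of the SU's queue of own packets. -/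
noncomputable def Ns : ℝ :=
  (p.lamP * p.lamS * p.A + (p.lamS ^ 2 - p.lamS) * p.B * (p.B + p.lamP)) / (p.B * p.C)

end Params

end CogRelay

/-! The queue lengths form a Markov chain driven by independent inputs. The relay queue and the SU's
own queue do not influence each other, so the pairs (PU, relay) and (PU, own) can be treated
separately. For each pair, the expected remaining work is a linear function `V` of the lengths. Its
drift is a negative constant in the stable region, plus one when both queues are empty
(`transition_relayV`, `transition_ownV`). Since jumps are bounded, `V` has uniformly bounded
exponential moments (`IsLyapunov.exp_moment`), so anything of quadratic growth has bounded second
moments. Each queue length `f` admits a quadratic solution `h` of Poisson's equation, with the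
claimed mean as constant `c` (`exists_isPoisson_primary`, `exists_isPoisson_relay`,
`exists_isPoisson_own`). This has two consequences, neither of which needs a stationary law. Means:
the sums of `E f - c` telescope and stay bounded. The dynamics preserve the order of states, so from
empty queues the means increase, and a monotone sequence with bounded sums of deviations converges
to `c`. Any other start dominates the empty one, and the same bounds make the difference vanish
(`IsPoisson.tendsto_integral`). Trajectories: `h` plus the sum of `f - c` is a martingale with
second moment of linear growth, which yields a strong law along squares and then everywhere
(`IsPoisson.ae_tendsto_average`). Applied to the indicator of empty queues with solution `-V`, it
shows that empty slots have positive frequency. Cutting time at empty slots then gives Little's law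
pathwise (`IsBuffer.hasAverageDelay`). -/

namespace CogRelay

/-! ### Averages over the inputs of a slot -/

/-- The inputs of one slot. -/
abbrev Bits := Input → Bool

noncomputable instance : DecidableEq Input := Classical.decEq _

noncomputable instance : Fintype Input :=
  ⟨{.arrP, .arrS, .chPD, .chPS, .chSD, .accept, .select}, fun i => by cases i <;> simp⟩

/-- The probability that a Bernoulli variable of parameter `q` takes the value `x`. -/
def bernoulliWeight (q : ℝ) (x : Bool) : ℝ := if x then q else 1 - q

/-- The probability of the inputs `b` of a slot. -/
noncomputable def Params.weight (p : Params) (b : Bits) : ℝ :=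
  ∏ i, bernoulliWeight (p.prob i) (b i)

/-- The expectation of a function of the inputs of a slot. -/
noncomputable def Params.avg (p : Params) (f : Bits → ℝ) : ℝ := ∑ b, p.weight b * f b

/-- The inputs of a slot as a tuple. -/
def bitsEquiv : Bits ≃ Bool × Bool × Bool × Bool × Bool × Bool × Bool where
  toFun b := (b .arrP, b .arrS, b .chPD, b .chPS, b .chSD, b .accept, b .select)
  invFun x := fun i => match i with
    | .arrP => x.1
    | .arrS => x.2.1
    | .chPD => x.2.2.1
    | .chPS => x.2.2.2.1
    | .chSD => x.2.2.2.2.1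
    | .accept => x.2.2.2.2.2.1
    | .select => x.2.2.2.2.2.2
  left_inv b := by funext i; cases i <;> rfl
  right_inv x := rfl

theorem prod_input (f : Input → ℝ) :
    ∏ i, f i = f .arrP * f .arrS * f .chPD * f .chPS * f .chSD * f .accept * f .select := by
  have : (Finset.univ : Finset Input)
      = {.arrP, .arrS, .chPD, .chPS, .chSD, .accept, .select} := rfl
  rw [this]
  simp [Finset.prod_insert, mul_assoc]

namespace Params

variable (p : Params)

theorem sum_weight : ∑ b, p.weight b = 1 := by
  have := Finset.prod_univ_sum (fun _ : Input => (Finset.univ : Finset Bool))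
    (fun i x => bernoulliWeight (p.prob i) x)
  rw [Fintype.piFinset_univ] at this
  unfold weight
  rw [← this]
  simp [bernoulliWeight]

theorem weight_nonneg (hp : ∀ i, 0 ≤ p.prob i ∧ p.prob i ≤ 1) (b : Bits) : 0 ≤ p.weight b := by
  refine Finset.prod_nonneg fun i _ => ?_
  unfold bernoulliWeight
  split_ifs <;> linarith [(hp i).1, (hp i).2]

theorem avg_const (c : ℝ) : p.avg (fun _ => c) = c := by
  simp [avg, ← Finset.sum_mul, sum_weight]

theorem avg_add (f g : Bits → ℝ) : p.avg (fun b => f b + g b) = p.avg f + p.avg g := by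
  simp [avg, mul_add, Finset.sum_add_distrib]

theorem avg_const_mul (c : ℝ) (f : Bits → ℝ) : p.avg (fun b => c * f b) = c * p.avg f := by
  simp only [avg, Finset.mul_sum]
  exact Finset.sum_congr rfl fun b _ => by ring

variable {p}

theorem avg_mono (hp : ∀ i, 0 ≤ p.prob i ∧ p.prob i ≤ 1) {f g : Bits → ℝ} (h : ∀ b, f b ≤ g b) :
    p.avg f ≤ p.avg g :=
  Finset.sum_le_sum fun b _ => mul_le_mul_of_nonneg_left (h b) (p.weight_nonneg hp b)

end Params

/-! ### Independent inputs -/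

/-- The inputs `ξ` are independent and have the probabilities `p`. -/
structure IsInput {Ω : Type*} [MeasurableSpace Ω] (P : Measure Ω) (p : Params)
    (ξ : ℕ → Input → Ω → Bool) : Prop where
  prob_mem : ∀ i, 0 ≤ p.prob i ∧ p.prob i ≤ 1
  meas : ∀ t i, Measurable (ξ t i)
  indep : iIndepFun (fun k : ℕ × Input => ξ k.1 k.2) P
  law : ∀ t i, P {ω | ξ t i ω = true} = ENNReal.ofReal (p.prob i)

/-- The sequence of inputs at a sample point. -/
abbrev path {Ω : Type*} (ξ : ℕ → Input → Ω → Bool) (ω : Ω) : ℕ → Bits := fun t i => ξ t i ω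

namespace IsInput

/-- The slots and inputs before slot `t`. -/
noncomputable abbrev before (t : ℕ) : Finset (ℕ × Input) := Finset.range t ×ˢ Finset.univ

/-- A sequence of inputs with the given inputs before slot `t`. -/
noncomputable def extend (t : ℕ) (x : before t → Bool) : ℕ → Bits := fun i j =>
  if h : (i, j) ∈ before t then x ⟨(i, j), h⟩ else false

/-- A functional of the past factors through finitely many bits. Its measurability, boundedness and
independence of slot `t` all come from this. -/
theorem eq_extend {Ω β : Type*} {ξ : ℕ → Input → Ω → Bool} {t : ℕ} {F : (ℕ → Bits) → β} (hF : DependsOn F (Set.Iio t))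
    (ω : Ω) : F (path ξ ω) = F (extend t fun k => ξ k.1.1 k.1.2 ω) := by
  apply hF
  intro i hi
  funext j
  simp [extend, path, Set.mem_Iio.1 hi]

variable {Ω : Type*} [MeasurableSpace Ω] {P : Measure Ω} {p : Params}
  {ξ : ℕ → Input → Ω → Bool}

theorem measure_eq [IsProbabilityMeasure P] (H : IsInput P p ξ) (t : ℕ) (i : Input) (x : Bool) :
    P (ξ t i ⁻¹' {x}) = ENNReal.ofReal (bernoulliWeight (p.prob i) x) := by
  have h1 : P (ξ t i ⁻¹' {true}) = ENNReal.ofReal (p.prob i) := H.law t i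
  cases x
  · have : ξ t i ⁻¹' {false} = (ξ t i ⁻¹' {true})ᶜ := by ext ω; simp
    rw [this, prob_compl_eq_one_sub (H.meas t i (measurableSet_singleton _)), h1]
    simp [bernoulliWeight, ENNReal.ofReal_sub _ (H.prob_mem i).1]
  · simpa [bernoulliWeight] using h1

theorem measure_path_eq [IsProbabilityMeasure P] (H : IsInput P p ξ) (t : ℕ) (b : Bits) :
    P {ω | path ξ ω t = b} = ENNReal.ofReal (p.weight b) := by
  have h := H.indep.measure_inter_preimage_eq_mul (({t} : Finset ℕ) ×ˢ Finset.univ)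
    (sets := fun k => {b k.2}) (fun _ _ => measurableSet_singleton _)
  have h2 : {ω | path ξ ω t = b}
      = ⋂ k ∈ ({t} : Finset ℕ) ×ˢ (Finset.univ : Finset Input), ξ k.1 k.2 ⁻¹' {b k.2} := by
    ext ω
    simp [path, funext_iff]
  rw [h2, h, Finset.prod_product, Finset.prod_singleton, Params.weight,
    ENNReal.ofReal_prod_of_nonneg]
  · exact Finset.prod_congr rfl fun i _ => H.measure_eq t i (b i)
  · intro i _
    unfold bernoulliWeight
    split_ifs <;> linarith [(H.prob_mem i).1, (H.prob_mem i).2]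

theorem measurable_comp (H : IsInput P p ξ) {t : ℕ} {F : (ℕ → Bits) → ℝ}
    (hF : DependsOn F (Set.Iio t)) : Measurable fun ω => F (path ξ ω) := by
  simp_rw [eq_extend hF]
  have h1 : Measurable fun ω => fun k : before t => ξ k.1.1 k.1.2 ω :=
    measurable_pi_lambda _ fun k => H.meas _ _
  exact (Measurable.of_discrete (f := fun x => F (extend t x))).comp h1

theorem integrable_comp [IsProbabilityMeasure P] (H : IsInput P p ξ) {t : ℕ} {F : (ℕ → Bits) → ℝ}
    (hF : DependsOn F (Set.Iio t)) : Integrable (fun ω => F (path ξ ω)) P := by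
  obtain ⟨C, hC⟩ := (Set.finite_range fun x : before t → Bool => ‖F (extend t x)‖).bddAbove
  refine Integrable.of_bound (H.measurable_comp hF).aestronglyMeasurable C ?_
  refine Eventually.of_forall fun ω => ?_
  rw [eq_extend hF]
  exact hC ⟨_, rfl⟩

/-- The inputs of slot `t` are averaged out, given those of the previous slots. -/
theorem integral_step [IsProbabilityMeasure P] (H : IsInput P p ξ) {t : ℕ} {F : (ℕ → Bits) → Bits → ℝ}
    (hF : ∀ b, DependsOn (fun u => F u b) (Set.Iio t)) :
    ∫ ω, F (path ξ ω) (path ξ ω t) ∂P = ∫ ω, p.avg (F (path ξ ω)) ∂P := by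
  -- For fixed `b`, the two functions depend on disjoint sets of bits: those before slot `t` and
  -- those of slot `t`.
  have hind : ∀ b, IndepFun (fun ω => F (path ξ ω) b)
      (fun ω => if path ξ ω t = b then (1 : ℝ) else 0) P := by
    intro b
    have h := H.indep.indepFun_finset (before t) (({t} : Finset ℕ) ×ˢ Finset.univ)
      (by
        rw [Finset.disjoint_left]
        rintro ⟨i, j⟩ h1 h2
        simp at h1 h2
        omega) (fun k => H.meas _ _)
    have h3 := h.comp (φ := fun x => F (extend t x) b)
      (ψ := fun x => if (∀ i, x ⟨(t, i), by simp⟩ = b i) then (1 : ℝ) else 0)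
      Measurable.of_discrete Measurable.of_discrete
    convert h3 using 1
    · funext ω
      exact eq_extend (hF b) ω
    · funext ω
      simp [path, funext_iff]
  have hm : ∀ b, Measurable fun ω => if path ξ ω t = b then (1 : ℝ) else 0 := by
    intro b
    exact H.measurable_comp (t := t + 1) (F := fun u => if u t = b then (1 : ℝ) else 0)
      (fun u v h => by simp [h t (by simp)])
  have hint : ∀ b, Integrable (fun ω => F (path ξ ω) b * if path ξ ω t = b then (1 : ℝ) else 0)
      P := by
    intro b
    refine H.integrable_comp (t := t + 1) (F := fun u => F u b * if u t = b then (1 : ℝ) else 0) ?_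
    intro u v h
    have h1 : F u b = F v b := hF b (fun i hi => h i (by simp at hi ⊢; omega))
    simp [h t (by simp), h1]
  have h1 : ∀ ω, F (path ξ ω) (path ξ ω t)
      = ∑ b, F (path ξ ω) b * if path ξ ω t = b then (1 : ℝ) else 0 := by
    intro ω; simp
  simp_rw [h1, Params.avg]
  rw [integral_finsetSum _ fun b _ => hint b,
    integral_finsetSum _ fun b _ => (H.integrable_comp (hF b)).const_mul _]
  refine Finset.sum_congr rfl fun b _ => ?_
  rw [(hind b).integral_fun_mul_eq_mul_integral (H.integrable_comp (hF b)).aestronglyMeasurable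
    (hm b).aestronglyMeasurable, integral_const_mul, mul_comm]
  congr 1
  have : (fun ω => if path ξ ω t = b then (1 : ℝ) else 0)
      = Set.indicator {ω | path ξ ω t = b} 1 := by
    funext ω; simp [Set.indicator]
  have hms : MeasurableSet {ω | path ξ ω t = b} := by
    have := hm b (measurableSet_singleton 1)
    convert this using 1
    ext ω; simp
  rw [this, integral_indicator_one hms, Measure.real, H.measure_path_eq,
    ENNReal.toReal_ofReal (p.weight_nonneg H.prob_mem b)]

end IsInput

/-! ### Markov chains driven by the inputs -/

section Chain

variable {S : Type*} (step : S → Bits → S) (s₀ : S)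

/-- The chain driven by the inputs `u`. -/
def chain (u : ℕ → Bits) : ℕ → S
  | 0 => s₀
  | t + 1 => step (chain u t) (u t)

theorem dependsOn_chain (t : ℕ) : DependsOn (fun u => chain step s₀ u t) (Set.Iio t) := by
  induction t with
  | zero => intro u v _; rfl
  | succ t ih =>
    intro u v h
    have h1 : chain step s₀ u t = chain step s₀ v t :=
      ih fun i hi => h i (by simp at hi ⊢; omega)
    simp [chain, h1, h t (by simp)]

theorem dependsOn_chain_comp {β : Type*} (f : S → β) (t : ℕ) :
    DependsOn (fun u => f (chain step s₀ u t)) (Set.Iio t) :=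
  fun _ _ h => congrArg f (dependsOn_chain step s₀ t h)

/-- The transition operator of the chain. -/
noncomputable def Params.transition (p : Params) (f : S → ℝ) (s : S) : ℝ :=
  p.avg fun b => f (step s b)

variable {step}
variable {Ω : Type*} [MeasurableSpace Ω] {P : Measure Ω} [IsProbabilityMeasure P] {p : Params}
  {ξ : ℕ → Input → Ω → Bool}

theorem IsInput.integrable_chain (H : IsInput P p ξ) (f : S → ℝ) (t : ℕ) :
    Integrable (fun ω => f (chain step s₀ (path ξ ω) t)) P :=
  H.integrable_comp (dependsOn_chain_comp step s₀ f t)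

theorem IsInput.integral_chain_succ (H : IsInput P p ξ) (f : S → ℝ) (t : ℕ) :
    ∫ ω, f (chain step s₀ (path ξ ω) (t + 1)) ∂P
      = ∫ ω, p.transition step f (chain step s₀ (path ξ ω) t) ∂P :=
  H.integral_step (F := fun u b => f (step (chain step s₀ u t) b))
    fun b => dependsOn_chain_comp step s₀ (fun s => f (step s b)) t

theorem IsInput.integral_chain (H : IsInput P p ξ) (f : S → ℝ) (t : ℕ) :
    ∫ ω, f (chain step s₀ (path ξ ω) t) ∂P = (p.transition step)^[t] f s₀ := by
  induction t generalizing f with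
  | zero => simp [chain]
  | succ t ih => rw [H.integral_chain_succ, ih, Function.iterate_succ_apply]

/-- `V` is a nonnegative function with bounded jumps and a uniformly negative drift off its zeros. -/
structure IsLyapunov (p : Params) (step : S → Bits → S) (V : S → ℝ) : Prop where
  nonneg : ∀ s, 0 ≤ V s
  jump : ∃ c, ∀ s b, |V (step s b) - V s| ≤ c
  drift : ∃ ε > 0, ∀ s, V s = 0 ∨ p.transition step V s ≤ V s - ε

/-- For small `θ`, a second-order expansion turns the additive drift of `V` into a contraction of
`exp (θ V)` by a factor `ρ < 1`, up to an additive constant. Iteration keeps the expectations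
bounded. -/
theorem IsLyapunov.exp_moment {V : S → ℝ} (hV : IsLyapunov p step V) (H : IsInput P p ξ) :
    ∃ θ > 0, ∃ K, ∀ t, ∫ ω, Real.exp (θ * V (chain step s₀ (path ξ ω) t)) ∂P ≤ K := by
  obtain ⟨c₀, hc₀⟩ := hV.jump
  obtain ⟨ε, hε, hε1, hd⟩ : ∃ ε > 0, ε ≤ 1 ∧ ∀ s, V s = 0 ∨ p.transition step V s ≤ V s - ε := by
    obtain ⟨ε, hε, hd⟩ := hV.drift
    refine ⟨min ε 1, lt_min hε one_pos, min_le_right _ _, fun s => (hd s).imp_right fun h => ?_⟩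
    linarith [min_le_left ε 1]
  obtain ⟨c, hc, hcpos⟩ : ∃ c, (∀ s b, |V (step s b) - V s| ≤ c) ∧ 0 < c :=
    ⟨max c₀ 1, fun s b => (hc₀ s b).trans (le_max_left _ _), lt_max_of_lt_right one_pos⟩
  -- The first bound puts the exponent in the range of the quadratic estimate, the second makes the
  -- error `(θ c) ^ 2` at most half of the gain `θ ε`, and the third, with `ε ≤ 1`, keeps `ρ`
  -- nonnegative.
  set θ := min (min (1 / c) (ε / (2 * c ^ 2))) 1 with hθ
  have hθpos : 0 < θ := lt_min (lt_min (by positivity) (by positivity)) one_pos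
  have hθc : θ * c ≤ 1 := by
    have : θ ≤ 1 / c := (min_le_left _ _).trans (min_le_left _ _)
    rwa [le_div_iff₀ hcpos] at this
  have hθε : θ * (2 * c ^ 2) ≤ ε := by
    have : θ ≤ ε / (2 * c ^ 2) := (min_le_left _ _).trans (min_le_right _ _)
    rwa [le_div_iff₀ (by positivity)] at this
  set ρ := 1 - θ * ε / 2 with hρ
  have hρ0 : 0 ≤ ρ := by
    have : θ * ε ≤ 1 * 1 := mul_le_mul (min_le_right _ _) hε1 hε.le zero_le_one
    rw [hρ]; linarith
  have hρ1 : 0 < 1 - ρ := by rw [hρ]; nlinarith [mul_pos hθpos hε]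
  have hone : ∀ s b, Real.exp (θ * V (step s b))
      ≤ Real.exp (θ * V s) * (1 + θ * (V (step s b) - V s) + (θ * c) ^ 2) := by
    intro s b
    have h1 : |θ * (V (step s b) - V s)| ≤ θ * c := by
      rw [abs_mul, abs_of_pos hθpos]
      exact mul_le_mul_of_nonneg_left (hc s b) hθpos.le
    have h2 := Real.abs_exp_sub_one_sub_id_le (h1.trans hθc)
    have h3 := (abs_le.1 h2).2
    have h4 : (θ * (V (step s b) - V s)) ^ 2 ≤ (θ * c) ^ 2 := sq_le_sq' (abs_le.1 h1).1 (abs_le.1 h1).2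
    have h5 : θ * V (step s b) = θ * V s + θ * (V (step s b) - V s) := by ring
    rw [h5, Real.exp_add]
    exact mul_le_mul_of_nonneg_left (by linarith) (Real.exp_pos _).le
  have htr : ∀ s, p.transition step (fun s => Real.exp (θ * V s)) s
      ≤ ρ * Real.exp (θ * V s) + 3 := by
    intro s
    rcases hd s with h0 | h0
    -- At a zero of `V` there is no drift, but the bound is `1 + θ c + (θ c) ^ 2 ≤ 3`.
    · have : p.transition step (fun s => Real.exp (θ * V s)) s ≤ p.avg fun _ => 3 := by
        refine Params.avg_mono H.prob_mem fun b => (hone s b).trans ?_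
        rw [h0, mul_zero, Real.exp_zero, one_mul]
        have h1 := (abs_le.1 (hc s b)).2
        rw [h0] at h1
        have h2 : θ * (V (step s b) - 0) ≤ θ * c := mul_le_mul_of_nonneg_left h1 hθpos.le
        have h3 : (θ * c) ^ 2 ≤ 1 := pow_le_one₀ (by positivity) hθc
        linarith
      rw [Params.avg_const] at this
      have := mul_nonneg hρ0 (Real.exp_pos (θ * V s)).le
      linarith
    · have h1 : p.transition step (fun s => Real.exp (θ * V s)) s
          ≤ p.avg fun b => Real.exp (θ * V s) * (1 - θ * V s + (θ * c) ^ 2 + θ * V (step s b)) := by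
        refine Params.avg_mono H.prob_mem fun b => (hone s b).trans (le_of_eq ?_)
        ring
      rw [Params.avg_const_mul, Params.avg_add, Params.avg_const, Params.avg_const_mul] at h1
      have h2 : 1 - θ * V s + (θ * c) ^ 2 + θ * p.avg (fun b => V (step s b)) ≤ ρ := by
        have h3 : θ * p.avg (fun b => V (step s b)) ≤ θ * (V s - ε) :=
          mul_le_mul_of_nonneg_left h0 hθpos.le
        have h4 : θ * (θ * (2 * c ^ 2)) ≤ θ * ε := mul_le_mul_of_nonneg_left hθε hθpos.le
        rw [hρ]
        nlinarith
      have h3 := mul_le_mul_of_nonneg_left h2 (Real.exp_pos (θ * V s)).le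
      linarith
  refine ⟨θ, hθpos, Real.exp (θ * V s₀) + 3 / (1 - ρ), fun t => ?_⟩
  induction t with
  | zero =>
    simp only [chain, integral_const, probReal_univ, smul_eq_mul, one_mul]
    linarith [div_pos three_pos hρ1]
  | succ t ih =>
    rw [H.integral_chain_succ s₀ (fun s => Real.exp (θ * V s))]
    have h1 := integral_mono (H.integrable_chain s₀ _ t)
      (((H.integrable_chain s₀ (fun s => Real.exp (θ * V s)) t).const_mul ρ).add
        (integrable_const (3 : ℝ))) (fun ω => htr (chain step s₀ (path ξ ω) t))
    refine h1.trans ?_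
    simp only [Pi.add_apply]
    rw [integral_add ((H.integrable_chain s₀ (fun s => Real.exp (θ * V s)) t).const_mul ρ)
        (integrable_const _), integral_const_mul]
    simp only [integral_const, probReal_univ, smul_eq_mul, one_mul]
    have h2 := mul_le_mul_of_nonneg_left ih hρ0
    have h3 : 3 / (1 - ρ) * (1 - ρ) = 3 := div_mul_cancel₀ _ hρ1.ne'
    nlinarith [Real.exp_pos (θ * V s₀)]

/-- The functions that grow at most quadratically with a Lyapunov function have bounded second
moments. -/
theorem IsLyapunov.sq_moment {V h : S → ℝ} (hV : IsLyapunov p step V) (H : IsInput P p ξ)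
    {C : ℝ} (hh : ∀ s, |h s| ≤ C * (1 + V s) ^ 2) :
    ∃ K, ∀ t, ∫ ω, h (chain step s₀ (path ξ ω) t) ^ 2 ∂P ≤ K := by
  obtain ⟨θ, hθ, K, hK⟩ := hV.exp_moment s₀ H
  refine ⟨C ^ 2 * (24 / θ ^ 4 * Real.exp θ) * K, fun t => ?_⟩
  have h1 : ∀ s, h s ^ 2 ≤ C ^ 2 * (24 / θ ^ 4 * Real.exp θ) * Real.exp (θ * V s) := by
    intro s
    -- The square of a quadratic bound has degree four, so the fourth term of the exponential series
    -- suffices.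
    have h2 : (θ * (1 + V s)) ^ 4 / (Nat.factorial 4 : ℕ) ≤ Real.exp (θ * (1 + V s)) :=
      Real.pow_div_factorial_le_exp _ (mul_nonneg hθ.le (by linarith [hV.nonneg s])) 4
    have h3 : (1 + V s) ^ 4 ≤ 24 / θ ^ 4 * Real.exp (θ * (1 + V s)) := by
      rw [div_mul_eq_mul_div, le_div_iff₀ (by positivity)]
      rw [div_le_iff₀ (by positivity)] at h2
      norm_num [Nat.factorial] at h2
      linarith
    have h4 : h s ^ 2 ≤ (C * (1 + V s) ^ 2) ^ 2 := by
      rw [← sq_abs]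
      exact pow_le_pow_left₀ (abs_nonneg _) (hh s) 2
    calc h s ^ 2 ≤ C ^ 2 * (1 + V s) ^ 4 := by linarith
      _ ≤ C ^ 2 * (24 / θ ^ 4 * Real.exp (θ * (1 + V s))) :=
        mul_le_mul_of_nonneg_left h3 (sq_nonneg C)
      _ = _ := by rw [mul_add, mul_one, Real.exp_add]; ring
  calc ∫ ω, h (chain step s₀ (path ξ ω) t) ^ 2 ∂P
      ≤ ∫ ω, C ^ 2 * (24 / θ ^ 4 * Real.exp θ)
        * Real.exp (θ * V (chain step s₀ (path ξ ω) t)) ∂P :=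
        integral_mono (H.integrable_chain s₀ (fun s => h s ^ 2) t)
          (H.integrable_chain s₀ (fun s => C ^ 2 * (24 / θ ^ 4 * Real.exp θ)
            * Real.exp (θ * V s)) t) fun ω => h1 _
    _ ≤ _ := by
        rw [integral_const_mul]
        exact mul_le_mul_of_nonneg_left (hK t) (by positivity)

/-! ### Poisson's equation -/

/-- `h` solves Poisson's equation for `f` with the constant `c`: the drift of `h` is `c - f`. -/
def IsPoisson (p : Params) (step : S → Bits → S) (f h : S → ℝ) (c : ℝ) : Prop :=
  ∀ s, p.transition step h s = h s + c - f s

theorem IsPoisson.integral_sum {f h : S → ℝ} {c : ℝ} (hP : IsPoisson p step f h c)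
    (H : IsInput P p ξ) (T : ℕ) :
    ∑ t ∈ Finset.range T, (∫ ω, f (chain step s₀ (path ξ ω) t) ∂P - c)
      = h s₀ - ∫ ω, h (chain step s₀ (path ξ ω) T) ∂P := by
  induction T with
  | zero => simp [chain]
  | succ T ih =>
    have h1 : (∫ ω, h (chain step s₀ (path ξ ω) (T + 1)) ∂P)
        = (∫ ω, h (chain step s₀ (path ξ ω) T) ∂P) + c
          - ∫ ω, f (chain step s₀ (path ξ ω) T) ∂P := by
      rw [H.integral_chain_succ]
      simp_rw [hP _]
      rw [integral_sub (H.integrable_chain s₀ (fun s => h s + c) T) (H.integrable_chain s₀ f T),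
        integral_add (H.integrable_chain s₀ h T) (integrable_const c)]
      simp
    rw [Finset.sum_range_succ, ih, h1]
    ring

/-- The telescoped sum leaves only two values of `h`. The bound is uniform in `T`, which is stronger
than Cesàro convergence and is what later yields convergence of the means themselves. -/
theorem IsPoisson.integral_sum_bounded {V f h : S → ℝ} {c C : ℝ} (hP : IsPoisson p step f h c)
    (hV : IsLyapunov p step V) (hh : ∀ s, |h s| ≤ C * (1 + V s) ^ 2) (H : IsInput P p ξ) :
    ∃ K, ∀ T, |∑ t ∈ Finset.range T, (∫ ω, f (chain step s₀ (path ξ ω) t) ∂P - c)| ≤ K := by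
  obtain ⟨K, hK⟩ := hV.sq_moment s₀ H hh
  refine ⟨|h s₀| + (1 + K), fun T => ?_⟩
  rw [hP.integral_sum s₀ H]
  refine (abs_sub _ _).trans (add_le_add le_rfl ?_)
  refine (abs_integral_le_integral_abs).trans ?_
  have h1 : ∫ ω, |h (chain step s₀ (path ξ ω) T)| ∂P
      ≤ ∫ ω, (1 + h (chain step s₀ (path ξ ω) T) ^ 2) ∂P := by
    refine integral_mono (H.integrable_chain s₀ (fun s => |h s|) T)
      (H.integrable_chain s₀ (fun s => 1 + h s ^ 2) T) fun ω => ?_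
    have := sq_nonneg (|h (chain step s₀ (path ξ ω) T)| - 1)
    simp only
    nlinarith [sq_abs (h (chain step s₀ (path ξ ω) T)),
      abs_nonneg (h (chain step s₀ (path ξ ω) T))]
  refine h1.trans ?_
  rw [integral_add (integrable_const _) (H.integrable_chain s₀ (fun s => h s ^ 2) T)]
  simpa using hK T

/-- The martingale of a solution of Poisson's equation. -/
def poissonMartingale (step : S → Bits → S) (s₀ : S) (f h : S → ℝ) (c : ℝ) (u : ℕ → Bits)
    (T : ℕ) : ℝ :=
  h (chain step s₀ u T) + ∑ t ∈ Finset.range T, (f (chain step s₀ u t) - c)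

theorem dependsOn_poissonMartingale (f h : S → ℝ) (c : ℝ) (T : ℕ) :
    DependsOn (fun u => poissonMartingale step s₀ f h c u T) (Set.Iio T) := by
  intro u v huv
  simp only [poissonMartingale]
  refine congrArg₂ _ (dependsOn_chain_comp step s₀ h T huv) (Finset.sum_congr rfl fun t ht => ?_)
  exact dependsOn_chain_comp step s₀ (fun s => f s - c) t
    fun i hi => huv i (by simp at hi ht ⊢; omega)

/-- Martingale increments are orthogonal to the past, and the conditional variance of an increment
is at most the conditional second moment of `h`, which is bounded in mean. -/
theorem IsPoisson.martingale_sq {V f h : S → ℝ} {c C : ℝ} (hP : IsPoisson p step f h c)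
    (hV : IsLyapunov p step V) (hh : ∀ s, |h s| ≤ C * (1 + V s) ^ 2) (H : IsInput P p ξ) :
    ∃ K, 0 ≤ K ∧ ∀ T : ℕ,
      ∫ ω, poissonMartingale step s₀ f h c (path ξ ω) T ^ 2 ∂P ≤ K * (T + 1) := by
  obtain ⟨K, hK⟩ := hV.sq_moment s₀ H hh
  have hK0 : 0 ≤ K := (integral_nonneg fun ω => sq_nonneg _).trans (hK 0)
  refine ⟨K + h s₀ ^ 2, by positivity, fun T => ?_⟩
  induction T with
  | zero => simp [poissonMartingale, chain, hK0]
  | succ T ih =>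
    set M : (ℕ → Bits) → ℝ := fun u => poissonMartingale step s₀ f h c u T with hM
    have hMdep : DependsOn M (Set.Iio T) := dependsOn_poissonMartingale s₀ f h c T
    have hstep : ∀ u, poissonMartingale step s₀ f h c u (T + 1)
        = (M u + f (chain step s₀ u T) - c - h (chain step s₀ u T))
          + h (step (chain step s₀ u T) (u T)) := by
      intro u
      simp only [hM, poissonMartingale, Finset.sum_range_succ, chain]
      ring
    have hint1 : Integrable (fun ω => M (path ξ ω) ^ 2) P :=
      H.integrable_comp (t := T) (F := fun u => M u ^ 2) fun u v huv => by simp only [hMdep huv]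
    have hint2 : Integrable
        (fun ω => p.transition step (fun s => h s ^ 2) (chain step s₀ (path ξ ω) T)) P :=
      H.integrable_chain s₀ _ T
    calc ∫ ω, poissonMartingale step s₀ f h c (path ξ ω) (T + 1) ^ 2 ∂P
        = ∫ ω, p.avg (fun b => ((M (path ξ ω) + f (chain step s₀ (path ξ ω) T) - c
            - h (chain step s₀ (path ξ ω) T)) + h (step (chain step s₀ (path ξ ω) T) b)) ^ 2) ∂P := by
          simp_rw [hstep]
          refine H.integral_step (F := fun u b => ((M u + f (chain step s₀ u T) - c
            - h (chain step s₀ u T)) + h (step (chain step s₀ u T) b)) ^ 2) fun b => ?_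
          intro u v huv
          simp only [hMdep huv, dependsOn_chain step s₀ T huv]
      _ ≤ ∫ ω, (M (path ξ ω) ^ 2
            + p.transition step (fun s => h s ^ 2) (chain step s₀ (path ξ ω) T)) ∂P := by
          refine integral_mono (H.integrable_comp (t := T) (F := fun u => p.avg fun b =>
            ((M u + f (chain step s₀ u T) - c
            - h (chain step s₀ u T)) + h (step (chain step s₀ u T) b)) ^ 2) ?_)
            (hint1.add hint2) fun ω => ?_
          · intro u v huv
            simp only [hMdep huv, dependsOn_chain step s₀ T huv]
          · set s := chain step s₀ (path ξ ω) T
            set a := M (path ξ ω) + f s - c - h s with ha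
            -- The next value of the martingale is `a` plus the new value of `h`, and its present
            -- value is `a` plus the conditional mean of `h`. The squares differ in mean by a
            -- conditional variance.
            have h1 : p.avg (fun b => (a + h (step s b)) ^ 2)
                = a ^ 2 + 2 * a * p.transition step h s
                  + p.transition step (fun s => h s ^ 2) s := by
              simp only [Params.transition]
              rw [← Params.avg_const p (a ^ 2), ← Params.avg_const_mul, ← Params.avg_add,
                ← Params.avg_add]
              congr 1
              funext b
              ring
            have h2 := hP s
            have h3 : M (path ξ ω) = a + p.transition step h s := by rw [h2, ha]; ring
            simp only [h1, h3]
            nlinarith [sq_nonneg (p.transition step h s)]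
      _ = ∫ ω, M (path ξ ω) ^ 2 ∂P + ∫ ω, h (chain step s₀ (path ξ ω) (T + 1)) ^ 2 ∂P := by
          rw [integral_add hint1 hint2, ← H.integral_chain_succ s₀ (fun s => h s ^ 2)]
      _ ≤ _ := by
          have := hK (T + 1)
          push_cast
          nlinarith [sq_nonneg (h s₀)]

/-- The law of large numbers for a nonnegative function for which Poisson's equation has a solution
of at most quadratic growth. -/
theorem IsPoisson.ae_tendsto_average {V f h : S → ℝ} {c C : ℝ} (hP : IsPoisson p step f h c)
    (hV : IsLyapunov p step V) (hh : ∀ s, |h s| ≤ C * (1 + V s) ^ 2) (hf : ∀ s, 0 ≤ f s)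
    (H : IsInput P p ξ) :
    ∀ᵐ ω ∂P, Tendsto (fun T : ℕ => (∑ t ∈ Finset.range T, f (chain step s₀ (path ξ ω) t)) / T)
      atTop (𝓝 c) := by
  obtain ⟨K₁, hK₁0, hK₁⟩ := hP.martingale_sq s₀ hV hh H
  obtain ⟨K₂, hK₂⟩ := hV.sq_moment s₀ H hh
  have hK₂0 : 0 ≤ K₂ := (integral_nonneg fun ω => sq_nonneg _).trans (hK₂ 0)
  set D : Ω → ℕ → ℝ := fun ω T => ∑ t ∈ Finset.range T, f (chain step s₀ (path ξ ω) t) - c * T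
    with hD
  have hDeq : ∀ ω T, D ω T = poissonMartingale step s₀ f h c (path ξ ω) T
      - h (chain step s₀ (path ξ ω) T) := by
    intro ω T
    simp [hD, poissonMartingale, Finset.sum_sub_distrib]
    ring
  have hDdep : ∀ T, DependsOn (fun u : ℕ → Bits => ((poissonMartingale step s₀ f h c u T
      - h (chain step s₀ u T)) / T) ^ 2) (Set.Iio T) := by
    intro T u v huv
    have := dependsOn_poissonMartingale (step := step) s₀ f h c T huv
    simp only at this
    simp only [this, dependsOn_chain step s₀ T huv]
  have hDint : ∀ T, Integrable (fun ω => (D ω T / T) ^ 2) P := by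
    intro T
    simp_rw [hDeq]
    exact H.integrable_comp (hDdep T)
  have hDmeas : ∀ T, Measurable (fun ω => (D ω T / T) ^ 2) := by
    intro T
    simp_rw [hDeq]
    exact H.measurable_comp (hDdep T)
  have hDsq : ∀ T : ℕ, 0 < T → ∫ ω, (D ω T / T) ^ 2 ∂P ≤ (4 * K₁ + 2 * K₂) / T := by
    intro T hT
    have hT1 : (1 : ℝ) ≤ T := by exact_mod_cast hT
    have hi1 : Integrable (fun ω => poissonMartingale step s₀ f h c (path ξ ω) T ^ 2) P :=
      H.integrable_comp (t := T) (F := fun u => poissonMartingale step s₀ f h c u T ^ 2)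
        fun u v huv => by
          have := dependsOn_poissonMartingale (step := step) s₀ f h c T huv
          simp only at this
          simp only [this]
    have hi2 := H.integrable_chain (step := step) s₀ (fun s => h s ^ 2) T
    have h1 : ∫ ω, (D ω T / T) ^ 2 ∂P ≤ ∫ ω, (2 / (T : ℝ) ^ 2)
        * (poissonMartingale step s₀ f h c (path ξ ω) T ^ 2
          + h (chain step s₀ (path ξ ω) T) ^ 2) ∂P := by
      refine integral_mono (hDint T) ((hi1.add hi2).const_mul _) fun ω => ?_
      simp only [hDeq]
      rw [div_pow, div_mul_eq_mul_div]
      refine div_le_div_of_nonneg_right ?_ (by positivity)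
      nlinarith [sq_nonneg (poissonMartingale step s₀ f h c (path ξ ω) T
        + h (chain step s₀ (path ξ ω) T))]
    refine h1.trans ?_
    rw [integral_const_mul, integral_add hi1 hi2, div_mul_eq_mul_div,
      div_le_div_iff₀ (by positivity) (by positivity)]
    have h2 := hK₁ T
    have h3 := hK₂ T
    have h4 : K₁ * (T + 1) + K₂ ≤ (2 * K₁ + K₂) * T := by nlinarith
    have h5 : 2 * (∫ ω, poissonMartingale step s₀ f h c (path ξ ω) T ^ 2 ∂P
        + ∫ ω, h (chain step s₀ (path ξ ω) T) ^ 2 ∂P) ≤ (4 * K₁ + 2 * K₂) * T := by linarith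
    have := mul_le_mul_of_nonneg_right h5 (show (0 : ℝ) ≤ T by positivity)
    linarith
  -- Along `T = (k + 1) ^ 2` the bound `O(1 / T)` is summable, so the series of squares has finite
  -- expectation.
  have hsum : ∀ᵐ ω ∂P, Summable fun k : ℕ => (D ω ((k + 1) ^ 2) / ((k + 1) ^ 2 : ℕ)) ^ 2 := by
    have h1 : ∑' k : ℕ, ∫⁻ ω, ENNReal.ofReal ((D ω ((k + 1) ^ 2) / ((k + 1) ^ 2 : ℕ)) ^ 2) ∂P
        ≠ ⊤ := by
      have h2 : ∀ k : ℕ, ∫⁻ ω, ENNReal.ofReal ((D ω ((k + 1) ^ 2) / ((k + 1) ^ 2 : ℕ)) ^ 2) ∂P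
          ≤ ENNReal.ofReal ((4 * K₁ + 2 * K₂) * (1 / ((k + 1 : ℕ) : ℝ) ^ 2)) := by
        intro k
        rw [← ofReal_integral_eq_lintegral_ofReal (hDint _)
          (Eventually.of_forall fun ω => sq_nonneg _)]
        refine ENNReal.ofReal_le_ofReal ((hDsq _ (by positivity)).trans (le_of_eq ?_))
        push_cast
        ring
      refine ne_top_of_le_ne_top ?_ (ENNReal.tsum_le_tsum h2)
      refine Summable.tsum_ofReal_ne_top (Summable.mul_left _ ?_)
      exact (summable_nat_add_iff 1).2 (Real.summable_one_div_nat_pow.2 one_lt_two)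
    rw [← lintegral_tsum fun k => (hDmeas _).ennreal_ofReal.aemeasurable] at h1
    have h3 := ae_lt_top' (AEMeasurable.tsum
      fun k => (hDmeas _).ennreal_ofReal.aemeasurable) h1
    filter_upwards [h3] with ω hω
    have := ENNReal.summable_toReal hω.ne
    refine this.congr fun k => ?_
    rw [ENNReal.toReal_ofReal (sq_nonneg _)]
  filter_upwards [hsum] with ω hω
  -- As `f ≥ 0`, the sums are monotone. Consecutive squares have ratios tending to one, so the limit
  -- along squares extends to all `T`.
  refine tendsto_div_of_monotone_of_exists_subseq_tendsto_div _ c ?_ ?_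
  · exact monotone_nat_of_le_succ fun T => by
      rw [Finset.sum_range_succ]
      linarith [hf (chain step s₀ (path ξ ω) T)]
  · intro a ha
    refine ⟨fun k => (k + 1) ^ 2, ?_, ?_, ?_⟩
    · have h1 : Tendsto (fun k : ℕ => (1 + 1 / ((k : ℝ) + 1)) ^ 2) atTop (𝓝 ((1 + 0) ^ 2)) :=
        (tendsto_const_nhds.add tendsto_one_div_add_atTop_nhds_zero_nat).pow 2
      filter_upwards [h1.eventually_le_const (u := a) (by simpa using ha)] with k hk
      push_cast
      have h2 : (0 : ℝ) < k + 1 := by positivity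
      have h3 : ((k : ℝ) + 1 + 1) ^ 2 = (1 + 1 / ((k : ℝ) + 1)) ^ 2 * (k + 1) ^ 2 := by
        field_simp
      rw [h3]
      exact mul_le_mul_of_nonneg_right hk (by positivity)
    · exact tendsto_atTop_mono (fun k => by simp only [id]; nlinarith) tendsto_id
    · have h1 := hω.tendsto_atTop_zero
      have h2 : Tendsto (fun k : ℕ => D ω ((k + 1) ^ 2) / ((k + 1) ^ 2 : ℕ)) atTop (𝓝 0) := by
        rw [tendsto_zero_iff_abs_tendsto_zero]
        have := h1.sqrt
        simpa [Real.sqrt_sq_eq_abs, Function.comp_def] using this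
      have h3 := h2.add_const c
      rw [zero_add] at h3
      refine h3.congr fun k => ?_
      have h4 : (((k + 1) ^ 2 : ℕ) : ℝ) ≠ 0 := by positivity
      simp only [hD]
      field_simp
      ring

end Chain

/-! ### Monotone chains -/

theorem tendsto_of_sum_bounded_of_le {a : ℕ → ℝ} {c K : ℝ}
    (hK : ∀ T, |∑ t ∈ Finset.range T, (a t - c)| ≤ K) (hle : ∀ t, c ≤ a t) :
    Tendsto a atTop (𝓝 c) := by
  have h1 : Summable fun t => a t - c :=
    summable_of_sum_range_le (fun t => sub_nonneg.2 (hle t)) fun T => (abs_le.1 (hK T)).2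
  simpa using h1.tendsto_atTop_zero.add_const c

/-- One term above `c` would keep all later terms above `c` by a fixed amount and make the sums
diverge. Hence all terms are at most `c`, and the deviations are summable. -/
theorem tendsto_of_sum_bounded_of_monotone {a : ℕ → ℝ} {c K : ℝ}
    (hK : ∀ T, |∑ t ∈ Finset.range T, (a t - c)| ≤ K) (hmono : Monotone a) :
    Tendsto a atTop (𝓝 c) := by
  have hle : ∀ t, a t ≤ c := by
    intro t₀
    by_contra! hlt
    obtain ⟨n, hn⟩ := exists_nat_gt ((K + K) / (a t₀ - c))
    rw [div_lt_iff₀ (sub_pos.2 hlt)] at hn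
    have h1 : n * (a t₀ - c) ≤ ∑ t ∈ Finset.Ico t₀ (t₀ + n), (a t - c) := by
      have := Finset.card_nsmul_le_sum (Finset.Ico t₀ (t₀ + n)) (fun t => a t - c) (a t₀ - c)
        fun t ht => by linarith [hmono (Finset.mem_Ico.1 ht).1]
      simpa using this
    rw [Finset.sum_Ico_eq_sub _ (Nat.le_add_right _ _)] at h1
    linarith [(abs_le.1 (hK (t₀ + n))).2, (abs_le.1 (hK t₀)).1]
  have h1 := tendsto_of_sum_bounded_of_le (a := fun t => -a t) (c := -c) (K := K)
    (fun T => by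
      have : ∑ t ∈ Finset.range T, (-a t - -c) = -∑ t ∈ Finset.range T, (a t - c) := by
        rw [← Finset.sum_neg_distrib]
        exact Finset.sum_congr rfl fun t _ => by ring
      rw [this, abs_neg]
      exact hK T) fun t => neg_le_neg (hle t)
  simpa using h1.neg

section MonotoneChain

variable {S : Type*} [PartialOrder S] {step : S → Bits → S} {p : Params}

theorem Params.transition_mono (hp : ∀ i, 0 ≤ p.prob i ∧ p.prob i ≤ 1)
    (hstep : ∀ b, Monotone fun s => step s b) {f : S → ℝ} (hf : Monotone f) :
    Monotone (p.transition step f) :=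
  fun _ _ h => Params.avg_mono hp fun b => hf (hstep b h)

theorem chain_mono (hstep : ∀ b, Monotone fun s => step s b) {s s' : S} (h : s ≤ s')
    (u : ℕ → Bits) (t : ℕ) : chain step s u t ≤ chain step s' u t := by
  induction t with
  | zero => exact h
  | succ t ih => exact hstep _ ih

variable [OrderBot S] {Ω : Type*} [MeasurableSpace Ω] {P : Measure Ω} [IsProbabilityMeasure P]
  {ξ : ℕ → Input → Ω → Bool}

/-- After one step the chain is above `⊥`, and the iterates of the transition operator preserve
monotone functions. -/
theorem IsInput.monotone_integral_chain_bot (H : IsInput P p ξ)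
    (hstep : ∀ b, Monotone fun s => step s b) {f : S → ℝ} (hf : Monotone f) :
    Monotone fun t => ∫ ω, f (chain step ⊥ (path ξ ω) t) ∂P := by
  refine monotone_nat_of_le_succ fun t => ?_
  have hit : Monotone ((p.transition step)^[t] f) := by
    induction t with
    | zero => exact hf
    | succ t ih =>
      rw [Function.iterate_succ_apply']
      exact Params.transition_mono H.prob_mem hstep ih
  rw [H.integral_chain, H.integral_chain, Function.iterate_succ_apply',
    ← p.avg_const ((p.transition step)^[t] f ⊥)]
  exact Params.avg_mono H.prob_mem fun b => hit bot_le

/-- The expectations of an increasing function converge, whatever the initial state. -/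
theorem IsPoisson.tendsto_integral {V f h : S → ℝ} {c C : ℝ} (hP : IsPoisson p step f h c)
    (hV : IsLyapunov p step V) (hh : ∀ s, |h s| ≤ C * (1 + V s) ^ 2)
    (hstep : ∀ b, Monotone fun s => step s b) (hf : Monotone f) (H : IsInput P p ξ) (s₀ : S) :
    Tendsto (fun t => ∫ ω, f (chain step s₀ (path ξ ω) t) ∂P) atTop (𝓝 c) := by
  obtain ⟨K, hK⟩ := hP.integral_sum_bounded s₀ hV hh H
  obtain ⟨K₀, hK₀⟩ := hP.integral_sum_bounded ⊥ hV hh H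
  have h0 := tendsto_of_sum_bounded_of_monotone hK₀ (H.monotone_integral_chain_bot hstep hf)
  -- Driven by the same inputs, the chain from `s₀` stays above the chain from `⊥`. The differences
  -- of means are thus nonnegative with bounded sums.
  have h1 : Tendsto (fun t => ∫ ω, f (chain step s₀ (path ξ ω) t) ∂P
      - ∫ ω, f (chain step ⊥ (path ξ ω) t) ∂P) atTop (𝓝 0) := by
    refine tendsto_of_sum_bounded_of_le (K := K + K₀) (fun T => ?_) fun t => ?_
    · have : ∑ t ∈ Finset.range T, (∫ ω, f (chain step s₀ (path ξ ω) t) ∂P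
          - ∫ ω, f (chain step ⊥ (path ξ ω) t) ∂P - 0)
          = ∑ t ∈ Finset.range T, (∫ ω, f (chain step s₀ (path ξ ω) t) ∂P - c)
            - ∑ t ∈ Finset.range T, (∫ ω, f (chain step ⊥ (path ξ ω) t) ∂P - c) := by
        rw [← Finset.sum_sub_distrib]
        exact Finset.sum_congr rfl fun t _ => by ring
      rw [this]
      exact (abs_sub _ _).trans (add_le_add (hK T) (hK₀ T))
    · exact sub_nonneg.2 (integral_mono (H.integrable_chain ⊥ f t) (H.integrable_chain s₀ f t)
        fun ω => hf (chain_mono hstep bot_le _ t))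
  simpa using h1.add h0

end MonotoneChain

/-! ### Little's law -/

/-- The evolution of a buffer: a packet is never duplicated, and only the packet of slot `t`
can enter in slot `t`. -/
structure IsBuffer (arr : ℕ → Bool) (L : ℕ → List Packet) : Prop where
  zero : ∀ a, (L 0).count (some a) = 0
  step : ∀ t x, (L (t + 1)).count x ≤ (L t).count x + if some t = x ∧ arr t = true then 1 else 0

namespace IsBuffer

variable {arr : ℕ → Bool} {L : ℕ → List Packet}

theorem count_le (h : IsBuffer arr L) (t a : ℕ) :
    (L t).count (some a) ≤ if a < t ∧ arr a = true then 1 else 0 := by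
  induction t with
  | zero => simp [h.zero]
  | succ t ih =>
    have := h.step t (some a)
    simp only [Option.some.injEq] at this
    split_ifs at * <;> first | omega | grind

theorem none_antitone (h : IsBuffer arr L) : Antitone fun t => (L t).count none :=
  antitone_nat_of_succ_le fun t => by simpa using h.step t none

theorem some_antitone (h : IsBuffer arr L) {a s t : ℕ} (ha : a < s) (hst : s ≤ t) :
    (L t).count (some a) ≤ (L s).count (some a) := by
  induction t, hst using Nat.le_induction with
  | base => exact le_rfl
  | succ t hst ih =>
    have := h.step t (some a)
    rw [if_neg (by simp; omega)] at this
    omega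

/-- The packets are cut off at `T` rather than at `t`, so that one index set serves all slots up to
`T`. -/
theorem length_eq (h : IsBuffer arr L) {t T : ℕ} (hT : t ≤ T) :
    (L t).length = (L t).count none
      + ∑ a ∈ (Finset.range T).filter (fun a => arr a = true), (L t).count (some a) := by
  classical
  have h1 := Multiset.sum_count_eq_card
    (s := insert none (((Finset.range T).filter (fun a => arr a = true)).image some))
    (m := (L t : Multiset Packet)) (by
      intro x hx
      rcases x with _ | a
      · simp
      · have h2 : 0 < (L t).count (some a) := List.count_pos_iff.2 (by simpa using hx)
        have h3 := h.count_le t a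
        split_ifs at h3 with h4
        · simp [h4.2]; omega
        · omega)
  rw [Finset.sum_insert (by simp), Finset.sum_image (by simp)] at h1
  simp only [Multiset.coe_count, Multiset.coe_card] at h1
  -- The multiset count and the list count use different equality tests on packets; lawful ones
  -- coincide.
  have hb : (instBEqOfDecidableEq : BEq (Option ℕ)) = Option.instBEq :=
    lawful_beq_subsingleton _ _
  rw [hb] at h1
  exact h1.symm

theorem sum_count_le (h : IsBuffer arr L) (t T : ℕ) :
    ∑ a ∈ (Finset.range T).filter (fun a => arr a = true), (L t).count (some a)
      ≤ (L t).length := by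
  refine le_trans (Finset.sum_le_sum_of_subset ?_)
    (le_trans (Nat.le_add_left _ _) (h.length_eq (le_max_left t T)).ge)
  exact Finset.filter_subset_filter _ (Finset.range_mono (le_max_right t T))

/-- The delay of a packet that is in the buffer in no slot from `ν` on. -/
theorem encard_eq (h : IsBuffer arr L) {a ν : ℕ} (ha : a < ν) (hν : L ν = []) :
    Set.encard {t | some a ∈ L t}
      = ((∑ t ∈ Finset.range ν, (L t).count (some a) : ℕ) : ℕ∞) := by
  have h1 : {t | some a ∈ L t} = ((Finset.range ν).filter (fun t => some a ∈ L t) : Finset ℕ) := by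
    ext t
    simp only [Set.mem_ofPred_eq, Finset.coe_filter, Finset.mem_range]
    refine ⟨fun ht => ⟨?_, ht⟩, fun ht => ht.2⟩
    by_contra! hle
    have h2 := h.some_antitone ha hle
    have h3 : 0 < (L t).count (some a) := List.count_pos_iff.2 ht
    rw [hν, List.count_nil] at h2
    omega
  rw [h1, Set.encard_coe_eq_coe_finsetCard, Finset.card_filter]
  congr 1
  refine Finset.sum_congr rfl fun t _ => ?_
  split_ifs with h4
  · have h3 : 0 < (L t).count (some a) := List.count_pos_iff.2 h4
    have h5 := h.count_le t a
    split_ifs at h5 <;> omega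
  · exact (List.count_eq_zero.2 h4).symm

/-- **Little's law** along a trajectory: the buffer is empty in the slots `e`, which
have a positive frequency. -/
theorem hasAverageDelay (h : IsBuffer arr L) {e : ℕ → Prop} [DecidablePred e]
    (he : ∀ t, e t → L t = []) {N ρ lam : ℝ}
    (hN : Tendsto (fun T : ℕ => (∑ t ∈ Finset.range T, ((L t).length : ℝ)) / T) atTop (𝓝 N))
    (hempty : Tendsto (fun T : ℕ => (∑ t ∈ Finset.range T, if e t then (1 : ℝ) else 0) / T)
      atTop (𝓝 ρ)) (hρ : 0 < ρ)
    (harr : Tendsto (fun T : ℕ => (∑ t ∈ Finset.range T, if arr t = true then (1 : ℝ) else 0) / T)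
      atTop (𝓝 lam)) (hlam : 0 < lam) :
    HasAverageDelay arr (fun a => Set.encard {t | some a ∈ L t}) (N / lam) := by
  set E : ℕ → ℝ := fun T => ∑ t ∈ Finset.range T, if e t then (1 : ℝ) else 0 with hE
  set W : ℕ → ℝ := fun T => ∑ t ∈ Finset.range T, ((L t).length : ℝ) with hW
  have hWmono : Monotone W := monotone_nat_of_le_succ fun T => by
    simp only [hW, Finset.sum_range_succ]
    linarith [(Nat.cast_nonneg (L T).length : (0 : ℝ) ≤ _)]
  have hcast : Tendsto (fun T : ℕ => (T : ℝ)) atTop atTop := tendsto_natCast_atTop_atTop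
  -- an empty slot in `[T, (1 + ε) T]`
  have hceil : ∀ ε > (0 : ℝ), Tendsto (fun T : ℕ => (⌈(1 + ε) * T⌉₊ : ℝ) / T) atTop
      (𝓝 (1 + ε)) := fun ε hε =>
    (tendsto_nat_ceil_mul_div_atTop (by linarith : (0 : ℝ) ≤ 1 + ε)).comp hcast
  have hceilT : ∀ ε > (0 : ℝ), Tendsto (fun T : ℕ => ⌈(1 + ε) * T⌉₊) atTop atTop := by
    intro ε hε
    refine tendsto_atTop_mono (fun T => ?_) tendsto_id
    have h1 : (T : ℝ) ≤ (⌈(1 + ε) * T⌉₊ : ℝ) :=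
      le_trans (by nlinarith [(Nat.cast_nonneg T : (0 : ℝ) ≤ T)]) (Nat.le_ceil _)
    exact_mod_cast h1
  have hscale : ∀ (F : ℕ → ℝ) (l : ℝ), Tendsto (fun T : ℕ => F T / T) atTop (𝓝 l) → ∀ ε > (0 : ℝ),
      Tendsto (fun T : ℕ => F ⌈(1 + ε) * T⌉₊ / T) atTop (𝓝 (l * (1 + ε))) := by
    intro F l hF ε hε
    refine ((hF.comp (hceilT ε hε)).mul (hceil ε hε)).congr' ?_
    filter_upwards [eventually_gt_atTop 0] with T hT
    have h1 : (0 : ℝ) < T := by exact_mod_cast hT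
    have h2 : (0 : ℝ) < (⌈(1 + ε) * T⌉₊ : ℝ) := lt_of_lt_of_le (by positivity) (Nat.le_ceil _)
    simp only [Function.comp]
    field_simp
  have hnext : ∀ ε > (0 : ℝ), ∀ᶠ T : ℕ in atTop,
      ∃ ν, T ≤ ν ∧ ν ≤ ⌈(1 + ε) * T⌉₊ ∧ L ν = [] := by
    intro ε hε
    -- The number of slots in `e` grows by about `ρ ε T` between `T` and `(1 + ε) T`, so one of them
    -- lies in between.
    have h1 := (hscale E ρ hempty ε hε).sub hempty
    have h2 := h1.eventually (lt_mem_nhds (show (0 : ℝ) < ρ * (1 + ε) - ρ by nlinarith))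
    filter_upwards [h2, eventually_gt_atTop 0] with T hT hT0
    by_contra! hno
    have h3 : (0 : ℝ) < T := by exact_mod_cast hT0
    rw [← sub_div] at hT
    have h4 : 0 < E ⌈(1 + ε) * T⌉₊ - E T := by
      by_contra! h5
      exact absurd hT (not_lt.2 (div_nonpos_of_nonpos_of_nonneg h5 h3.le))
    have h5 : T ≤ ⌈(1 + ε) * T⌉₊ := by
      have h1 : (T : ℝ) ≤ (⌈(1 + ε) * T⌉₊ : ℝ) := le_trans (by nlinarith) (Nat.le_ceil _)
      exact_mod_cast h1
    simp only [hE] at h4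
    rw [← Finset.sum_Ico_eq_sub _ h5, Finset.sum_eq_zero] at h4
    · exact lt_irrefl _ h4
    · intro t ht
      rw [Finset.mem_Ico] at ht
      rw [if_neg fun h => hno t ht.1 ht.2.le (he t h)]
  have hexists : ∀ a, ∃ ν, a < ν ∧ L ν = [] := by
    intro a
    obtain ⟨T, ⟨ν, h1, -, h2⟩, h3⟩ := ((hnext 1 one_pos).and (eventually_gt_atTop a)).exists
    exact ⟨ν, h3.trans_le h1, h2⟩
  have hfin : ∀ a, Set.encard {t | some a ∈ L t} ≠ ⊤ := by
    intro a
    obtain ⟨ν, h1, h2⟩ := hexists a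
    rw [h.encard_eq h1 h2]
    exact ENat.natCast_ne_top _
  refine ⟨fun a _ => hfin a, ?_⟩
  set Dl : ℕ → ℝ := fun T => ∑ a ∈ (Finset.range T).filter (fun a => arr a = true),
    (((Set.encard {t | some a ∈ L t}).toNat : ℕ) : ℝ) with hDl
  -- By an empty slot `ν ≥ T` all packets of the first `T` slots have left, so their total delay can
  -- be counted slot by slot.
  have hDeq : ∀ {T ν : ℕ}, T ≤ ν → L ν = [] → Dl T = ∑ t ∈ Finset.range ν,
      ((∑ a ∈ (Finset.range T).filter (fun a => arr a = true), (L t).count (some a) : ℕ) : ℝ) := by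
    intro T ν hT hν
    simp only [hDl]
    push_cast
    rw [Finset.sum_comm]
    refine Finset.sum_congr rfl fun a ha => ?_
    rw [h.encard_eq ((Finset.mem_range.1 (Finset.mem_filter.1 ha).1).trans_le hT) hν,
      ENat.toNat_natCast]
    push_cast
    rfl
  have hupper : ∀ {T ν : ℕ}, T ≤ ν → L ν = [] → Dl T ≤ W ν := by
    intro T ν hT hν
    rw [hDeq hT hν]
    exact Finset.sum_le_sum fun t _ => by exact_mod_cast h.sum_count_le t T
  obtain ⟨ν₀, -, hν₀⟩ := hexists 0
  -- Up to `T`, the queue holds only initial packets and packets of the first `T` slots. The initial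
  -- ones are gone at `ν₀` and cost at most `W ν₀`.
  have hlower : ∀ T, W T - W ν₀ ≤ Dl T := by
    intro T
    obtain ⟨ν, hT, hν⟩ := hexists T
    rw [hDeq hT.le hν]
    have h1 : W T = ∑ t ∈ Finset.range T, (((L t).count none : ℕ) : ℝ) + ∑ t ∈ Finset.range T,
        ((∑ a ∈ (Finset.range T).filter (fun a => arr a = true), (L t).count (some a) : ℕ) : ℝ) := by
      simp only [hW]
      rw [← Finset.sum_add_distrib]
      refine Finset.sum_congr rfl fun t ht => ?_
      rw [h.length_eq (Finset.mem_range.1 ht).le]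
      push_cast
      rfl
    have h2 : ∑ t ∈ Finset.range T, (((L t).count none : ℕ) : ℝ) ≤ W ν₀ := by
      simp only [hW]
      have h3 : ∀ t, t ∉ Finset.range ν₀ → (L t).count none = 0 := by
        intro t ht
        have := h.none_antitone (not_lt.1 (mt Finset.mem_range.2 ht))
        simpa [hν₀] using this
      calc ∑ t ∈ Finset.range T, (((L t).count none : ℕ) : ℝ)
          ≤ ∑ t ∈ Finset.range (max T ν₀), (((L t).count none : ℕ) : ℝ) :=
            Finset.sum_le_sum_of_subset_of_nonneg (by intro t; simp; omega)
              fun _ _ _ => Nat.cast_nonneg _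
        _ = ∑ t ∈ Finset.range ν₀, (((L t).count none : ℕ) : ℝ) := by
            refine (Finset.sum_subset (by intro t; simp; omega) fun t _ ht => ?_).symm
            simp [h3 t ht]
        _ ≤ _ := Finset.sum_le_sum fun t _ => by exact_mod_cast List.count_le_length
    have h4 : ∑ t ∈ Finset.range T,
        ((∑ a ∈ (Finset.range T).filter (fun a => arr a = true), (L t).count (some a) : ℕ) : ℝ)
        ≤ ∑ t ∈ Finset.range ν,
        ((∑ a ∈ (Finset.range T).filter (fun a => arr a = true), (L t).count (some a) : ℕ) : ℝ) :=
      Finset.sum_le_sum_of_subset_of_nonneg (Finset.range_mono hT.le)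
        fun _ _ _ => Nat.cast_nonneg _
    linarith
  have hD : Tendsto (fun T : ℕ => Dl T / T) atTop (𝓝 N) := by
    have hlow : Tendsto (fun T : ℕ => (W T - W ν₀) / T) atTop (𝓝 N) := by
      have := hN.sub (tendsto_const_nhds.div_atTop hcast : Tendsto (fun T : ℕ => W ν₀ / T) _ _)
      simpa only [sub_div, sub_zero] using this
    refine tendsto_order.2 ⟨fun b hb => ?_, fun b hb => ?_⟩
    · filter_upwards [hlow.eventually (lt_mem_nhds hb)] with T hT
      exact hT.trans_le (div_le_div_of_nonneg_right (hlower T) (Nat.cast_nonneg T))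
    · obtain ⟨ε, hε, hb'⟩ : ∃ ε > (0 : ℝ), N * (1 + ε) < b := by
        have h1 : Tendsto (fun ε : ℝ => N * (1 + ε)) (𝓝[>] 0) (𝓝 (N * (1 + 0))) :=
          (Continuous.tendsto (by fun_prop) 0).mono_left nhdsWithin_le_nhds
        obtain ⟨ε, h2, h3⟩ := ((h1.eventually (gt_mem_nhds (by simpa using hb))).and
          self_mem_nhdsWithin).exists
        exact ⟨ε, h3, h2⟩
      filter_upwards [(hscale W N hN ε hε).eventually (gt_mem_nhds hb'), hnext ε hε]
        with T hT ⟨ν, h1, h2, h3⟩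
      exact lt_of_le_of_lt (div_le_div_of_nonneg_right ((hupper h1 h3).trans (hWmono h2))
        (Nat.cast_nonneg T)) hT
  refine (hD.div harr hlam.ne').congr' ?_
  filter_upwards [eventually_gt_atTop 0] with T hT
  have h1 : (T : ℝ) ≠ 0 := by positivity
  simp only [Pi.div_apply, Finset.card_filter, hDl]
  rw [div_div_div_cancel_right₀ h1]
  push_cast
  rfl

end IsBuffer

/-! ### The queue lengths -/

/-- The evolution of the lengths of the PU's queue, the relay queue and the SU's queue. -/
def countStep (s : ℕ × ℕ × ℕ) (b : Bits) : ℕ × ℕ × ℕ :=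
  ((if b .chPD || (b .chPS && b .accept) then s.1 - 1 else s.1) + (b .arrP).toNat,
   if s.1 = 0 then (if b .chSD && !b .select then s.2.1 - 1 else s.2.1)
     else s.2.1 + (!b .chPD && (b .chPS && b .accept)).toNat,
   (if s.1 = 0 ∧ (b .chSD && b .select) = true then s.2.2 - 1 else s.2.2) + (b .arrS).toNat)

/-- The queue lengths of a state. -/
def State.counts (s : State) : ℕ × ℕ × ℕ := (s.qP.length, s.qSP.length, s.qS.length)

theorem State.counts_step (s : State) (t : ℕ) (b : Bits) :
    ((s.transmit b).arrive t b).counts = countStep s.counts b := by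
  rcases s with ⟨_ | ⟨x, l⟩, l₂, l₃⟩
  · cases h1 : b .chSD <;> cases h2 : b .select <;> cases h3 : b .arrP <;> cases h4 : b .arrS <;>
      simp [State.counts, State.transmit, State.arrive, countStep, h1, h2, h3, h4]
  · cases h1 : b .chPD <;> cases h2 : (b .chPS && b .accept) <;> cases h3 : b .arrP <;>
      cases h4 : b .arrS <;>
      simp [State.counts, State.transmit, State.arrive, countStep, h1, h2, h3, h4]

theorem counts_run (s₀ : State) (u : ℕ → Bits) (t : ℕ) :
    (run s₀ u t).counts = chain countStep s₀.counts u t := by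
  induction t with
  | zero => rfl
  | succ t ih => rw [chain, ← ih, run, State.counts_step]

/-- The critical case is a PU idle in the smaller state only. In the larger state the SU is then
blocked, so its queues cannot fall below. -/
theorem countStep_mono (b : Bits) : Monotone fun s => countStep s b := by
  rintro ⟨q, x, y⟩ ⟨q', x', y'⟩ ⟨h1, h2, h3⟩
  simp only at h1 h2 h3
  refine ⟨?_, ?_, ?_⟩
  · simp only [countStep]
    split_ifs <;> omega
  · simp only [countStep]
    split_ifs <;> omega
  · simp only [countStep]
    split_ifs <;> first | omega | grind

namespace Params

variable (p : Params)

/-- The probability that the SU serves the relay queue in a slot in which the PU is idle. -/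
noncomputable def σ : ℝ := p.fsd * (1 - p.pq)

/-- The probability that the SU serves its own queue in a slot in which the PU is idle. -/
noncomputable def τ : ℝ := p.pq * p.fsd

/-- In this form an average expands into its 128 explicit terms. -/
theorem avg_eq_sum (f : Bits → ℝ) : p.avg f = ∑ x : Bool × Bool × Bool × Bool × Bool × Bool × Bool,
    bernoulliWeight p.lamP x.1 * bernoulliWeight p.lamS x.2.1 * bernoulliWeight p.fpd x.2.2.1
      * bernoulliWeight p.fps x.2.2.2.1 * bernoulliWeight p.fsd x.2.2.2.2.1
      * bernoulliWeight p.pa x.2.2.2.2.2.1 * bernoulliWeight p.pq x.2.2.2.2.2.2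
      * f (bitsEquiv.symm x) := by
  rw [avg]
  refine Fintype.sum_equiv bitsEquiv _ _ fun b => ?_
  rw [Equiv.symm_apply_apply, weight, prod_input]
  rfl

theorem transition_relay_idle (g : ℕ → ℕ → ℝ) (x y : ℕ) :
    p.transition countStep (fun s => g s.1 s.2.1) (0, x, y)
      = p.lamP * (p.σ * g 1 (x - 1) + (1 - p.σ) * g 1 x)
        + (1 - p.lamP) * (p.σ * g 0 (x - 1) + (1 - p.σ) * g 0 x) := by
  simp only [transition, avg_eq_sum, Fintype.sum_prod_type, Fintype.sum_bool, countStep, bitsEquiv,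
    Equiv.coe_fn_symm_mk, bernoulliWeight, σ]
  simp
  ring

theorem transition_relay_busy (g : ℕ → ℕ → ℝ) (k x y : ℕ) :
    p.transition countStep (fun s => g s.1 s.2.1) (k + 1, x, y)
      = p.lamP * (p.fpd * g (k + 1) x + p.r * g (k + 1) (x + 1) + (1 - p.μ) * g (k + 2) x)
        + (1 - p.lamP) * (p.fpd * g k x + p.r * g k (x + 1) + (1 - p.μ) * g (k + 1) x) := by
  simp only [transition, avg_eq_sum, Fintype.sum_prod_type, Fintype.sum_bool, countStep, bitsEquiv,
    Equiv.coe_fn_symm_mk, bernoulliWeight, μ, r]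
  simp
  ring

/-- Arrivals follow service, hence `y - 1 + 1`: with truncated subtraction it equals `1` at `y = 0`,
as a packet is not served in its arrival slot. -/
theorem transition_own_idle (g : ℕ → ℕ → ℝ) (x y : ℕ) :
    p.transition countStep (fun s => g s.1 s.2.2) (0, x, y)
      = p.lamP * (p.lamS * (p.τ * g 1 (y - 1 + 1) + (1 - p.τ) * g 1 (y + 1))
          + (1 - p.lamS) * (p.τ * g 1 (y - 1) + (1 - p.τ) * g 1 y))
        + (1 - p.lamP) * (p.lamS * (p.τ * g 0 (y - 1 + 1) + (1 - p.τ) * g 0 (y + 1))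
          + (1 - p.lamS) * (p.τ * g 0 (y - 1) + (1 - p.τ) * g 0 y)) := by
  simp only [transition, avg_eq_sum, Fintype.sum_prod_type, Fintype.sum_bool, countStep, bitsEquiv,
    Equiv.coe_fn_symm_mk, bernoulliWeight, τ]
  simp
  ring

theorem transition_own_busy (g : ℕ → ℕ → ℝ) (k x y : ℕ) :
    p.transition countStep (fun s => g s.1 s.2.2) (k + 1, x, y)
      = p.lamP * (p.lamS * (p.μ * g (k + 1) (y + 1) + (1 - p.μ) * g (k + 2) (y + 1))
          + (1 - p.lamS) * (p.μ * g (k + 1) y + (1 - p.μ) * g (k + 2) y))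
        + (1 - p.lamP) * (p.lamS * (p.μ * g k (y + 1) + (1 - p.μ) * g (k + 1) (y + 1))
          + (1 - p.lamS) * (p.μ * g k y + (1 - p.μ) * g (k + 1) y)) := by
  simp only [transition, avg_eq_sum, Fintype.sum_prod_type, Fintype.sum_bool, countStep, bitsEquiv,
    Equiv.coe_fn_symm_mk, bernoulliWeight, μ, r]
  simp
  ring

/-! ### Stability -/

/-- The bounds on the parameters and their consequences in the stable region. -/
structure Regular : Prop where
  lamP_nonneg : 0 ≤ p.lamP
  lamS_nonneg : 0 ≤ p.lamS
  r_nonneg : 0 ≤ p.r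
  μ_pos : 0 < p.μ
  σ_pos : 0 < p.σ
  τ_pos : 0 < p.τ
  lamP_lt : p.lamP < p.μ
  relay : 0 < p.σ * p.μ - p.lamP * (p.σ + p.r)
  own : 0 < p.τ * (p.μ - p.lamP) - p.lamS * p.μ

variable {p}

theorem Stable.regular (hs : p.Stable) (hp : ∀ i, 0 ≤ p.prob i ∧ p.prob i ≤ 1) : p.Regular := by
  obtain ⟨h1, h2⟩ := hs
  have hlamP : 0 ≤ p.lamP := (hp .arrP).1
  have hlamS : 0 ≤ p.lamS := (hp .arrS).1
  have hr : 0 ≤ p.r := mul_nonneg (mul_nonneg (hp .accept).1 (hp .chPS).1)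
    (sub_nonneg.2 (hp .chPD).2)
  have hμ0 : 0 ≤ p.μ := add_nonneg (hp .chPD).1 hr
  have hσ0 : 0 ≤ p.σ := mul_nonneg (hp .chSD).1 (sub_nonneg.2 (hp .select).2)
  have hτ0 : 0 ≤ p.τ := mul_nonneg (hp .select).1 (hp .chSD).1
  change p.lamS < p.τ * (1 - p.lamP / p.μ) at h1
  change p.lamP < p.σ * p.μ / (p.σ + p.r) at h2
  -- Since division by zero gives zero, positivity of the bound excludes `σ = 0` and `μ = 0`.
  have h3 : 0 < p.σ * p.μ / (p.σ + p.r) := hlamP.trans_lt h2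
  have hσ : 0 < p.σ := hσ0.lt_of_ne fun h => by simp [← h] at h3
  have hμ : 0 < p.μ := hμ0.lt_of_ne fun h => by simp [← h] at h3
  have hτ : 0 < p.τ := hτ0.lt_of_ne fun h => by simp [← h] at h1; linarith
  have h4 : 0 < p.σ + p.r := by linarith
  rw [lt_div_iff₀ h4] at h2
  have h5 : p.lamP < p.μ := by
    by_contra! h6
    nlinarith [mul_nonneg hlamP hr, mul_le_mul_of_nonneg_left h6 hσ0]
  refine ⟨hlamP, hlamS, hr, hμ, hσ, hτ, h5, by linarith, ?_⟩
  have h7 := mul_lt_mul_of_pos_right h1 hμ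
  have h8 : p.τ * (1 - p.lamP / p.μ) * p.μ = p.τ * (p.μ - p.lamP) := by field_simp
  linarith

end Params

theorem abs_linear_step_le {a b : ℝ} (ha : 0 ≤ a) (hb : 0 ≤ b) {q q' x x' : ℕ}
    (hq : q' ≤ q + 1 ∧ q ≤ q' + 1) (hx : x' ≤ x + 1 ∧ x ≤ x' + 1) :
    |(a * q' + b * x') - (a * q + b * x)| ≤ a + b := by
  have h1 : (q' : ℝ) ≤ q + 1 := by exact_mod_cast hq.1
  have h2 : (q : ℝ) ≤ q' + 1 := by exact_mod_cast hq.2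
  have h3 : (x' : ℝ) ≤ x + 1 := by exact_mod_cast hx.1
  have h4 : (x : ℝ) ≤ x' + 1 := by exact_mod_cast hx.2
  rw [abs_le]
  constructor <;> nlinarith

theorem countStep_jump (s : ℕ × ℕ × ℕ) (b : Bits) :
    ((countStep s b).1 ≤ s.1 + 1 ∧ s.1 ≤ (countStep s b).1 + 1) ∧
    ((countStep s b).2.1 ≤ s.2.1 + 1 ∧ s.2.1 ≤ (countStep s b).2.1 + 1) ∧
    ((countStep s b).2.2 ≤ s.2.2 + 1 ∧ s.2.2 ≤ (countStep s b).2.2 + 1) := by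
  have h1 := Bool.toNat_le (b .arrP)
  have h2 := Bool.toNat_le (b .arrS)
  have h3 := Bool.toNat_le (!b .chPD && (b .chPS && b .accept))
  simp only [countStep]
  refine ⟨?_, ?_, ?_⟩ <;> split_ifs <;> omega

/-- A quadratic polynomial in two queue lengths. -/
def quad (c₁ c₂ c₃ c₄ c₅ : ℝ) (q x : ℕ) : ℝ :=
  c₁ * q ^ 2 + c₂ * q + c₃ * x ^ 2 + c₄ * x + c₅ * (q * x)

theorem abs_quad_le (c₁ c₂ c₃ c₄ c₅ : ℝ) {a b : ℝ} (ha : 0 < a) (hb : 0 < b) :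
    ∃ C, ∀ q x : ℕ, |quad c₁ c₂ c₃ c₄ c₅ q x| ≤ C * (1 + (a * q + b * x)) ^ 2 := by
  obtain ⟨k, hk1, hka, hkb⟩ : ∃ k : ℝ, 1 ≤ k ∧ 1 ≤ k * a ∧ 1 ≤ k * b := by
    refine ⟨1 + 1 / a + 1 / b, ?_, ?_, ?_⟩
    · have := one_div_pos.2 ha; have := one_div_pos.2 hb; linarith
    · have h1 : 1 / a * a = 1 := by field_simp
      have := mul_pos (one_div_pos.2 hb) ha
      nlinarith
    · have h1 : 1 / b * b = 1 := by field_simp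
      have := mul_pos (one_div_pos.2 ha) hb
      nlinarith
  refine ⟨(|c₁| + |c₂| + |c₃| + |c₄| + |c₅|) * k ^ 2, fun q x => ?_⟩
  have hq : (0 : ℝ) ≤ q := Nat.cast_nonneg q
  have hx : (0 : ℝ) ≤ x := Nat.cast_nonneg x
  have h1 : 1 + (q : ℝ) + x ≤ k * (1 + (a * q + b * x)) := by nlinarith
  have h2 : (1 + (q : ℝ) + x) ^ 2 ≤ k ^ 2 * (1 + (a * q + b * x)) ^ 2 := by
    rw [← mul_pow]
    exact pow_le_pow_left₀ (by positivity) h1 2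
  have hterm : ∀ c z : ℝ, 0 ≤ z → z ≤ (1 + (q : ℝ) + x) ^ 2 →
      |c * z| ≤ |c| * (1 + (q : ℝ) + x) ^ 2 := fun c z h0 h => by
    rw [abs_mul, abs_of_nonneg h0]
    exact mul_le_mul_of_nonneg_left h (abs_nonneg c)
  have e1 := hterm c₁ (q ^ 2) (by positivity) (by nlinarith)
  have e2 := hterm c₂ q hq (by nlinarith)
  have e3 := hterm c₃ (x ^ 2) (by positivity) (by nlinarith)
  have e4 := hterm c₄ x hx (by nlinarith)
  have e5 := hterm c₅ (q * x) (by positivity) (by nlinarith)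
  calc |quad c₁ c₂ c₃ c₄ c₅ q x|
      ≤ |c₁ * (q : ℝ) ^ 2| + |c₂ * (q : ℝ)| + |c₃ * (x : ℝ) ^ 2| + |c₄ * (x : ℝ)|
        + |c₅ * ((q : ℝ) * x)| := by
        unfold quad
        refine (abs_add_le _ _).trans (add_le_add ?_ le_rfl)
        refine (abs_add_le _ _).trans (add_le_add ?_ le_rfl)
        refine (abs_add_le _ _).trans (add_le_add ?_ le_rfl)
        exact abs_add_le _ _
    _ ≤ (|c₁| + |c₂| + |c₃| + |c₄| + |c₅|) * (1 + (q : ℝ) + x) ^ 2 := by linarith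
    _ ≤ _ := by
        rw [mul_assoc]
        exact mul_le_mul_of_nonneg_left h2 (by positivity)

/-! ### Lyapunov functions and solutions of Poisson's equation -/

namespace Params

variable (p : Params)

/-- A linear function of the lengths of the PU's queue and the relay queue. -/
noncomputable def relayV (s : ℕ × ℕ × ℕ) : ℝ :=
  (p.σ + p.r) / (p.σ * p.μ) * s.1 + 1 / p.σ * s.2.1

/-- A linear function of the lengths of the PU's queue and the SU's queue. -/
noncomputable def ownV (s : ℕ × ℕ × ℕ) : ℝ := 1 / p.μ * s.1 + 1 / p.τ * s.2.2

/-- The frequency of the slots in which the PU's queue and the relay queue are empty. -/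
noncomputable def relayIdle : ℝ := 1 - p.lamP * ((p.σ + p.r) / (p.σ * p.μ))

/-- The frequency of the slots in which the PU's queue and the SU's queue are empty. -/
noncomputable def ownIdle : ℝ := 1 - p.lamP / p.μ - p.lamS / p.τ

variable {p}

namespace Regular

theorem relayIdle_pos (h : p.Regular) : 0 < p.relayIdle := by
  have h1 := h.σ_pos
  have h2 := h.μ_pos
  have h3 : p.relayIdle = (p.σ * p.μ - p.lamP * (p.σ + p.r)) / (p.σ * p.μ) := by
    unfold relayIdle
    field_simp
  rw [h3]
  exact div_pos h.relay (by positivity)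

theorem ownIdle_pos (h : p.Regular) : 0 < p.ownIdle := by
  have h1 := h.τ_pos
  have h2 := h.μ_pos
  have h3 : p.ownIdle = (p.τ * (p.μ - p.lamP) - p.lamS * p.μ) / (p.τ * p.μ) := by
    unfold ownIdle
    field_simp
  rw [h3]
  exact div_pos h.own (by positivity)

theorem relayV_coeff_pos (h : p.Regular) : 0 < (p.σ + p.r) / (p.σ * p.μ) :=
  div_pos (by linarith [h.σ_pos, h.r_nonneg]) (mul_pos h.σ_pos h.μ_pos)

/-- A relay packet needs `1 / σ` PU-idle slots on average. A PU packet needs `1 / μ` slots and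
becomes a relay packet with probability `r / μ`, which gives its coefficient `1 / μ + r / (μ σ)`.
Every slot removes one unit of mean work unless both queues are empty, and arrivals add `1 -
relayIdle`. -/
theorem transition_relayV (h : p.Regular) (s : ℕ × ℕ × ℕ) :
    p.transition countStep p.relayV s
      = p.relayV s - p.relayIdle + if s.1 = 0 ∧ s.2.1 = 0 then 1 else 0 := by
  have h1 := h.σ_pos.ne'
  have h2 := h.μ_pos.ne'
  rcases s with ⟨_ | k, x, y⟩
  · refine (p.transition_relay_idle
      (fun q x => (p.σ + p.r) / (p.σ * p.μ) * q + 1 / p.σ * x) x y).trans ?_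
    simp only [relayV, relayIdle]
    rcases x with _ | x
    · simp only [Nat.cast_zero, Nat.cast_one, zero_tsub, and_self, if_true]
      ring
    · simp
      field_simp
      ring
  · refine (p.transition_relay_busy
      (fun q x => (p.σ + p.r) / (p.σ * p.μ) * q + 1 / p.σ * x) k x y).trans ?_
    simp only [relayV, relayIdle]
    have h3 : p.fpd = p.μ - p.r := by simp [μ]
    rw [h3]
    simp
    field_simp
    ring

theorem transition_ownV (h : p.Regular) (s : ℕ × ℕ × ℕ) :
    p.transition countStep p.ownV s
      = p.ownV s - p.ownIdle + if s.1 = 0 ∧ s.2.2 = 0 then 1 else 0 := by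
  have h1 := h.τ_pos.ne'
  have h2 := h.μ_pos.ne'
  rcases s with ⟨_ | k, x, y⟩
  · refine (p.transition_own_idle
      (fun q x => 1 / p.μ * q + 1 / p.τ * x) x y).trans ?_
    simp only [ownV, ownIdle]
    rcases y with _ | y
    · simp
      field_simp
      ring
    · simp
      field_simp
      ring
  · refine (p.transition_own_busy
      (fun q x => 1 / p.μ * q + 1 / p.τ * x) k x y).trans ?_
    simp only [ownV, ownIdle]
    simp
    field_simp
    ring

theorem isLyapunov_relayV (h : p.Regular) : IsLyapunov p countStep p.relayV where
  nonneg s := by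
    have h1 := h.relayV_coeff_pos
    have h2 := h.σ_pos
    unfold relayV
    positivity
  jump := ⟨_, fun s b => abs_linear_step_le h.relayV_coeff_pos.le (one_div_pos.2 h.σ_pos).le
    (countStep_jump s b).1 (countStep_jump s b).2.1⟩
  drift := by
    refine ⟨p.relayIdle, h.relayIdle_pos, fun s => ?_⟩
    rw [h.transition_relayV]
    by_cases h1 : s.1 = 0 ∧ s.2.1 = 0
    · left
      simp [relayV, h1]
    · right
      simp [h1]

theorem isLyapunov_ownV (h : p.Regular) : IsLyapunov p countStep p.ownV where
  nonneg s := by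
    have h1 := h.μ_pos
    have h2 := h.τ_pos
    unfold ownV
    positivity
  jump := ⟨_, fun s b => abs_linear_step_le (one_div_pos.2 h.μ_pos).le (one_div_pos.2 h.τ_pos).le
    (countStep_jump s b).1 (countStep_jump s b).2.2⟩
  drift := by
    refine ⟨p.ownIdle, h.ownIdle_pos, fun s => ?_⟩
    rw [h.transition_ownV]
    by_cases h1 : s.1 = 0 ∧ s.2.2 = 0
    · left
      simp [ownV, h1]
    · right
      simp [h1]

/-- The drift identity, read as Poisson's equation; it supplies the positive frequency of empty
slots for Little's law. -/
theorem isPoisson_relayIdle (h : p.Regular) : IsPoisson p countStep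
    (fun s => if s.1 = 0 ∧ s.2.1 = 0 then 1 else 0) (fun s => -p.relayV s) p.relayIdle := by
  intro s
  have h1 : p.transition countStep (fun s => -p.relayV s) s
      = -p.transition countStep p.relayV s := by
    simpa [transition] using p.avg_const_mul (-1) (fun b => p.relayV (countStep s b))
  rw [h1, h.transition_relayV]
  ring

theorem isPoisson_ownIdle (h : p.Regular) : IsPoisson p countStep
    (fun s => if s.1 = 0 ∧ s.2.2 = 0 then 1 else 0) (fun s => -p.ownV s) p.ownIdle := by
  intro s
  have h1 : p.transition countStep (fun s => -p.ownV s) s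
      = -p.transition countStep p.ownV s := by
    simpa [transition] using p.avg_const_mul (-1) (fun b => p.ownV (countStep s b))
  rw [h1, h.transition_ownV]
  ring

theorem exists_isPoisson_primary (h : p.Regular) : ∃ c₁ c₂ : ℝ, IsPoisson p countStep
    (fun s => (s.1 : ℝ)) (fun s => quad c₁ c₂ 0 0 0 s.1 s.2.1) p.Np := by
  have h1 : p.μ - p.lamP ≠ 0 := (sub_pos.2 h.lamP_lt).ne'
  have h3 : p.fpd = p.μ - p.r := by simp [μ]
  refine ⟨1 / (2 * (p.μ - p.lamP)), 1 / (2 * (p.μ - p.lamP)) * (1 - 2 * p.lamP), ?_⟩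
  rintro ⟨_ | k, x, y⟩
  · rw [p.transition_relay_idle (quad _ _ 0 0 0)]
    simp [quad, Np]
    field_simp
    ring
  · rw [p.transition_relay_busy (quad _ _ 0 0 0), h3]
    simp [quad, Np]
    field_simp
    ring

/-- The denominator factors into two quantities that are positive in the stable region. -/
theorem Nsp_eq (h : p.Regular) : p.Nsp = p.lamP * p.r * (p.μ + p.lamP * ((p.σ + p.r) / p.μ
    - (p.σ + p.r) - 1)) / ((p.μ - p.lamP) * (p.σ * p.μ - p.lamP * (p.σ + p.r))) := by
  have h2 := h.μ_pos.ne'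
  have h3 : p.fpd = p.μ - p.r := by simp [μ]
  unfold Nsp
  congr 1
  · simp only [m, n, h3, σ]
    field_simp
    ring
  · simp only [α, β, γ, σ]
    ring

/-- Comparing coefficients in a quadratic ansatz gives a solvable linear system. The empty state
yields the constant `(c₁ + c₂) * lamP`. -/
theorem exists_isPoisson_relay (h : p.Regular) : ∃ c₁ c₂ c₃ c₄ c₅ : ℝ, IsPoisson p countStep
    (fun s => (s.2.1 : ℝ)) (fun s => quad c₁ c₂ c₃ c₄ c₅ s.1 s.2.1) p.Nsp := by
  have h1 : p.μ - p.lamP ≠ 0 := (sub_pos.2 h.lamP_lt).ne'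
  have h2 := h.μ_pos.ne'
  have h3 : p.fpd = p.μ - p.r := by simp [μ]
  have h4 := h.relay.ne'
  -- The relations `e1` and `e2` (terms in `x`, PU idle and busy) determine `c₃` and `c₅`, with
  -- determinant `2 * Δ`. Then `e3` gives `c₁`, the idle constant term gives `c₄`, and the busy
  -- constant term `e4` gives `c₂`. The constants stay opaque so that only these relations are used.
  obtain ⟨Δ, hΔ⟩ : ∃ Δ, Δ = p.σ * p.μ - p.lamP * (p.σ + p.r) := ⟨_, rfl⟩
  obtain ⟨c₃, hc₃⟩ : ∃ c, c = p.μ / (2 * Δ) := ⟨_, rfl⟩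
  obtain ⟨c₅, hc₅⟩ : ∃ c, c = (p.σ + p.r) / Δ := ⟨_, rfl⟩
  obtain ⟨c₁, hc₁⟩ : ∃ c, c = p.r * c₅ / (2 * (p.μ - p.lamP)) := ⟨_, rfl⟩
  obtain ⟨c₄, hc₄⟩ : ∃ c, c = c₃ - p.lamP * c₅ := ⟨_, rfl⟩
  obtain ⟨c₂, hc₂⟩ : ∃ c, c = (c₁ * p.μ * (1 - 2 * p.lamP) + p.r * (c₃ + c₄)
    + p.r * (p.lamP - 1) * c₅) / p.μ := ⟨_, rfl⟩
  rw [← hΔ] at h4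
  have e1 : -2 * p.σ * c₃ + p.lamP * c₅ = -1 := by
    rw [hc₃, hc₅]; field_simp; rw [hΔ]; ring
  have e2 : 2 * p.r * c₃ + (p.lamP - p.μ) * c₅ = -1 := by
    rw [hc₃, hc₅]; field_simp; rw [hΔ]; ring
  have e3 : p.r * c₅ + 2 * (p.lamP - p.μ) * c₁ = 0 := by
    rw [hc₁]; field_simp; ring
  have e4 : c₂ * p.μ = c₁ * p.μ * (1 - 2 * p.lamP) + p.r * (c₃ + c₄)
      + p.r * (p.lamP - 1) * c₅ := by
    rw [hc₂]; field_simp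
  have eN : p.Nsp = (c₁ + c₂) * p.lamP := by
    rw [h.Nsp_eq, ← hΔ, hc₂, hc₄, hc₁, hc₃, hc₅]
    field_simp
    ring
  refine ⟨c₁, c₂, c₃, c₄, c₅, ?_⟩
  rintro ⟨_ | k, x, y⟩
  · rw [p.transition_relay_idle (quad _ _ _ _ _), eN]
    rcases x with _ | x
    · simp [quad]
      ring
    · simp [quad]
      rw [hc₄]
      linear_combination ((x : ℝ) + 1) * e1
  · rw [p.transition_relay_busy (quad _ _ _ _ _), h3, eN]
    simp [quad]
    linear_combination (x : ℝ) * e2 + ((k : ℝ) + 1) * e3 - e4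

theorem exists_isPoisson_own (h : p.Regular) : ∃ c₁ c₂ c₃ c₄ c₅ : ℝ, IsPoisson p countStep
    (fun s => (s.2.2 : ℝ)) (fun s => quad c₁ c₂ c₃ c₄ c₅ s.1 s.2.2) p.Ns := by
  have h1 : p.μ - p.lamP ≠ 0 := (sub_pos.2 h.lamP_lt).ne'
  have h2 := h.μ_pos.ne'
  have h4 := h.own.ne'
  obtain ⟨Δ, hΔ⟩ : ∃ Δ, Δ = p.τ * (p.μ - p.lamP) - p.lamS * p.μ := ⟨_, rfl⟩
  obtain ⟨c₃, hc₃⟩ : ∃ c, c = p.μ / (2 * Δ) := ⟨_, rfl⟩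
  obtain ⟨c₅, hc₅⟩ : ∃ c, c = p.τ / Δ := ⟨_, rfl⟩
  obtain ⟨c₁, hc₁⟩ : ∃ c, c = p.lamS * c₅ / (2 * (p.μ - p.lamP)) := ⟨_, rfl⟩
  -- This makes the constant term the same for `y = 0` and `y > 0` when the PU is idle; `c₂` does
  -- the same for a busy PU.
  obtain ⟨c₄, hc₄⟩ : ∃ c, c = c₃ * (1 - 2 * p.lamS) - p.lamP * c₅ := ⟨_, rfl⟩
  obtain ⟨c₂, hc₂⟩ : ∃ c, c = c₁ * (1 - 2 * p.lamP) - c₅ * p.lamS := ⟨_, rfl⟩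
  rw [← hΔ] at h4
  have e1 : 2 * (p.lamS - p.τ) * c₃ + p.lamP * c₅ = -1 := by
    rw [hc₃, hc₅]; field_simp; rw [hΔ]; ring
  have e2 : 2 * p.lamS * c₃ + (p.lamP - p.μ) * c₅ = -1 := by
    rw [hc₃, hc₅]; field_simp; rw [hΔ]; ring
  have e3 : p.lamS * c₅ + 2 * (p.lamP - p.μ) * c₁ = 0 := by
    rw [hc₁]; field_simp; ring
  have eN : p.Ns = (c₁ + c₂) * p.lamP + (c₃ + c₄) * p.lamS + c₅ * p.lamS * p.lamP := by
    have hC : p.C = -Δ := by rw [hΔ]; simp only [C, τ]; ring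
    have hA : p.A = p.τ * (p.μ - 1) := rfl
    rw [Ns, hC, hA, hc₂, hc₄, hc₁, hc₃, hc₅, B]
    field_simp
    ring
  refine ⟨c₁, c₂, c₃, c₄, c₅, ?_⟩
  rintro ⟨_ | k, x, y⟩
  · rw [p.transition_own_idle (quad _ _ _ _ _), eN]
    rcases y with _ | y
    · simp [quad]
      ring
    · simp [quad]
      rw [hc₄]
      linear_combination ((y : ℝ) + 1) * e1
  · rw [p.transition_own_busy (quad _ _ _ _ _), eN]
    simp [quad]
    rw [hc₂]
    linear_combination (y : ℝ) * e2 + ((k : ℝ) + 1) * e3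

end Regular

end Params

/-! ### The buffers of the two users -/

/-- Concatenated, the two queues form a single buffer: a relayed packet moves within it, and its
time there is its whole delay. -/
theorem isBuffer_relay (nP nSP nS : ℕ) (u : ℕ → Bits) : IsBuffer (fun t => u t .arrP)
    (fun t => (run (initial nP nSP nS) u t).qP ++ (run (initial nP nSP nS) u t).qSP) where
  zero a := by simp [run, initial, List.count_replicate]
  step t x := by
    rw [run]
    rcases run (initial nP nSP nS) u t with ⟨_ | ⟨z, l⟩, l₂, l₃⟩
    · have h := (List.tail_sublist l₂).count_le x
      cases h1 : u t .chSD <;> cases h2 : u t .select <;> cases h3 : u t .arrP <;>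
        simp [State.transmit, State.arrive, h1, h2, h3, List.count_cons] <;> omega
    · cases h1 : u t .chPD <;> cases h2 : (u t .chPS && u t .accept) <;> cases h3 : u t .arrP <;>
        simp [State.transmit, State.arrive, h1, h2, h3, List.count_cons] <;> omega

theorem isBuffer_own (nP nSP nS : ℕ) (u : ℕ → Bits) : IsBuffer (fun t => u t .arrS)
    (fun t => (run (initial nP nSP nS) u t).qS) where
  zero a := by simp [run, initial, List.count_replicate]
  step t x := by
    rw [run]
    rcases run (initial nP nSP nS) u t with ⟨_ | ⟨z, l⟩, l₂, l₃⟩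
    · have h := (List.tail_sublist l₃).count_le x
      cases h1 : u t .chSD <;> cases h2 : u t .select <;> cases h3 : u t .arrS <;>
        simp [State.transmit, State.arrive, h1, h2, h3, List.count_singleton] <;> omega
    · cases h1 : u t .chPD <;> cases h2 : (u t .chPS && u t .accept) <;> cases h3 : u t .arrS <;>
        simp [State.transmit, State.arrive, h1, h2, h3, List.count_singleton]

/-! ### Frequencies of the inputs -/

section

variable {Ω : Type*} [MeasurableSpace Ω] {P : Measure Ω} [IsProbabilityMeasure P] {p : Params}
  {ξ : ℕ → Input → Ω → Bool}

theorem IsInput.ae_tendsto_input (H : IsInput P p ξ) (i : Input) :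
    ∀ᵐ ω ∂P, Tendsto (fun T : ℕ => (∑ t ∈ Finset.range T, if ξ t i ω = true then (1 : ℝ) else 0)
      / T) atTop (𝓝 (p.prob i)) := by
  have hmeas : Measurable fun x : Bool => if x = true then (1 : ℝ) else 0 := Measurable.of_discrete
  have hX : ∀ t, Measurable fun ω => if ξ t i ω = true then (1 : ℝ) else 0 :=
    fun t => hmeas.comp (H.meas t i)
  have hms : ∀ t, MeasurableSet {ω | ξ t i ω = true} :=
    fun t => H.meas t i (measurableSet_singleton true)
  have hid : ∀ t, IdentDistrib (ξ t i) (ξ 0 i) P P := by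
    intro t
    refine ⟨(H.meas t i).aemeasurable, (H.meas 0 i).aemeasurable, ?_⟩
    refine Measure.ext_of_singleton fun x => ?_
    rw [Measure.map_apply (H.meas t i) (measurableSet_singleton x),
      Measure.map_apply (H.meas 0 i) (measurableSet_singleton x), H.measure_eq, H.measure_eq]
  have h := strong_law_ae_real (μ := P) (fun t ω => if ξ t i ω = true then (1 : ℝ) else 0)
    (Integrable.of_bound (hX 0).aestronglyMeasurable 1
      (Eventually.of_forall fun ω => by split_ifs <;> simp))
    (fun s t hst => (H.indep.indepFun (i := (s, i)) (j := (t, i)) (by simpa using hst)).comp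
      hmeas hmeas)
    (fun t => (hid t).comp hmeas)
  have hE : ∫ ω, (if ξ 0 i ω = true then (1 : ℝ) else 0) ∂P = p.prob i := by
    have : (fun ω => if ξ 0 i ω = true then (1 : ℝ) else 0)
        = Set.indicator {ω | ξ 0 i ω = true} 1 := by
      funext ω; simp [Set.indicator]
    rw [this, integral_indicator_one (hms 0), Measure.real, H.law,
      ENNReal.toReal_ofReal (H.prob_mem i).1]
  rw [hE] at h
  exact h

end

end CogRelay

/-! ### The main theorem -/

theorem theorem3 {Ω : Type*} [MeasurableSpace Ω] (P : Measure Ω) [IsProbabilityMeasure P]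
    (p : CogRelay.Params)
    (hp : ∀ i, 0 ≤ p.prob i ∧ p.prob i ≤ 1)
    (hstable : p.Stable)
    (ξ : ℕ → CogRelay.Input → Ω → Bool)
    (hmeas : ∀ t i, Measurable (ξ t i))
    (hindep : iIndepFun (fun k : ℕ × CogRelay.Input => ξ k.1 k.2) P)
    (hlaw : ∀ t i, P {ω | ξ t i ω = true} = ENNReal.ofReal (p.prob i))
    (nP nSP nS : ℕ) :
    let s₀ := CogRelay.initial nP nSP nS
    let u : Ω → ℕ → CogRelay.Input → Bool := fun ω t i => ξ t i ω
    CogRelay.HasAverageLength P (fun t ω => (CogRelay.run s₀ (u ω) t).qP.length) p.Np ∧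
    CogRelay.HasAverageLength P (fun t ω => (CogRelay.run s₀ (u ω) t).qSP.length) p.Nsp ∧
    CogRelay.HasAverageLength P (fun t ω => (CogRelay.run s₀ (u ω) t).qS.length) p.Ns ∧
    (0 < p.lamP → ∀ᵐ ω ∂P, CogRelay.HasAverageDelay (fun t => ξ t .arrP ω)
      (CogRelay.delayP s₀ (u ω)) ((p.Np + p.Nsp) / p.lamP)) ∧
    (0 < p.lamS → ∀ᵐ ω ∂P, CogRelay.HasAverageDelay (fun t => ξ t .arrS ω)
      (CogRelay.delayS s₀ (u ω)) (p.Ns / p.lamS)) := by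
  intro s₀ u
  have H : CogRelay.IsInput P p ξ := ⟨hp, hmeas, hindep, hlaw⟩
  have hreg := hstable.regular hp
  obtain ⟨a₁, a₂, hprim⟩ := hreg.exists_isPoisson_primary
  obtain ⟨b₁, b₂, b₃, b₄, b₅, hrel⟩ := hreg.exists_isPoisson_relay
  obtain ⟨c₁, c₂, c₃, c₄, c₅, hown⟩ := hreg.exists_isPoisson_own
  have hV := hreg.isLyapunov_relayV
  have hV' := hreg.isLyapunov_ownV
  have hquad : ∀ d₁ d₂ d₃ d₄ d₅ : ℝ, ∃ C, ∀ s : ℕ × ℕ × ℕ,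
      |CogRelay.quad d₁ d₂ d₃ d₄ d₅ s.1 s.2.1| ≤ C * (1 + p.relayV s) ^ 2 := fun _ _ _ _ _ =>
    (CogRelay.abs_quad_le _ _ _ _ _ hreg.relayV_coeff_pos (one_div_pos.2 hreg.σ_pos)).imp
      fun _ h s => h s.1 s.2.1
  obtain ⟨A₁, hA₁⟩ := hquad a₁ a₂ 0 0 0
  obtain ⟨A₂, hA₂⟩ := hquad b₁ b₂ b₃ b₄ b₅
  obtain ⟨A₃, hA₃⟩ : ∃ C, ∀ s : ℕ × ℕ × ℕ,
      |CogRelay.quad c₁ c₂ c₃ c₄ c₅ s.1 s.2.2| ≤ C * (1 + p.ownV s) ^ 2 :=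
    (CogRelay.abs_quad_le _ _ _ _ _ (one_div_pos.2 hreg.μ_pos) (one_div_pos.2 hreg.τ_pos)).imp
      fun _ h s => h s.1 s.2.2
  have hneg : ∀ v : ℝ, 0 ≤ v → |-v| ≤ 1 * (1 + v) ^ 2 := fun v hv => by
    rw [abs_neg, abs_of_nonneg hv]
    nlinarith
  have hcounts : ∀ ω t, (CogRelay.run s₀ (u ω) t).counts
      = CogRelay.chain CogRelay.countStep s₀.counts (CogRelay.path ξ ω) t :=
    fun ω t => CogRelay.counts_run s₀ (u ω) t
  have hP : ∀ ω t, (CogRelay.run s₀ (u ω) t).qP.length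
      = (CogRelay.chain CogRelay.countStep s₀.counts (CogRelay.path ξ ω) t).1 :=
    fun ω t => congrArg (fun s => s.1) (hcounts ω t)
  have hSP : ∀ ω t, (CogRelay.run s₀ (u ω) t).qSP.length
      = (CogRelay.chain CogRelay.countStep s₀.counts (CogRelay.path ξ ω) t).2.1 :=
    fun ω t => congrArg (fun s => s.2.1) (hcounts ω t)
  have hS : ∀ ω t, (CogRelay.run s₀ (u ω) t).qS.length
      = (CogRelay.chain CogRelay.countStep s₀.counts (CogRelay.path ξ ω) t).2.2 :=
    fun ω t => congrArg (fun s => s.2.2) (hcounts ω t)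
  refine ⟨?_, ?_, ?_, fun hlam => ?_, fun hlam => ?_⟩
  · simp only [CogRelay.HasAverageLength, hP]
    exact ⟨fun t => H.integrable_chain _ (fun s : ℕ × ℕ × ℕ => (s.1 : ℝ)) t,
      hprim.tendsto_integral hV hA₁ CogRelay.countStep_mono
        (fun _ _ h => Nat.cast_le.2 h.1) H _⟩
  · simp only [CogRelay.HasAverageLength, hSP]
    exact ⟨fun t => H.integrable_chain _ (fun s : ℕ × ℕ × ℕ => (s.2.1 : ℝ)) t,
      hrel.tendsto_integral hV hA₂ CogRelay.countStep_mono
        (fun _ _ h => Nat.cast_le.2 h.2.1) H _⟩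
  · simp only [CogRelay.HasAverageLength, hS]
    exact ⟨fun t => H.integrable_chain _ (fun s : ℕ × ℕ × ℕ => (s.2.2 : ℝ)) t,
      hown.tendsto_integral hV' hA₃ CogRelay.countStep_mono
        (fun _ _ h => Nat.cast_le.2 h.2.2) H _⟩
  · filter_upwards [hprim.ae_tendsto_average s₀.counts hV hA₁ (fun s => Nat.cast_nonneg _) H,
      hrel.ae_tendsto_average s₀.counts hV hA₂ (fun s => Nat.cast_nonneg _) H,
      hreg.isPoisson_relayIdle.ae_tendsto_average s₀.counts hV
        (fun s => hneg _ (hV.nonneg s)) (fun s => by split_ifs <;> simp) H,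
      H.ae_tendsto_input .arrP] with ω h1 h2 h3 h4
    have h := (CogRelay.isBuffer_relay nP nSP nS (u ω)).hasAverageDelay
      (e := fun t => (CogRelay.run s₀ (u ω) t).qP.length = 0
        ∧ (CogRelay.run s₀ (u ω) t).qSP.length = 0)
      (fun t ht => by simpa using ht)
      ((h1.add h2).congr fun T => ?_) (h3.congr fun T => ?_) hreg.relayIdle_pos h4 hlam
    · simp only [List.mem_append] at h
      exact h
    · rw [← add_div, ← Finset.sum_add_distrib]
      simp only [← hP, ← hSP, List.length_append, Nat.cast_add]
      rfl
    · simp only [← hP, ← hSP]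
  · filter_upwards [hown.ae_tendsto_average s₀.counts hV' hA₃ (fun s => Nat.cast_nonneg _) H,
      hreg.isPoisson_ownIdle.ae_tendsto_average s₀.counts hV'
        (fun s => hneg _ (hV'.nonneg s)) (fun s => by split_ifs <;> simp) H,
      H.ae_tendsto_input .arrS] with ω h1 h3 h4
    refine (CogRelay.isBuffer_own nP nSP nS (u ω)).hasAverageDelay
      -- Slots with both queues empty are only some of those with `qS` empty, but their frequency is
      -- known and positive, which suffices.
      (e := fun t => (CogRelay.run s₀ (u ω) t).qP.length = 0
        ∧ (CogRelay.run s₀ (u ω) t).qS.length = 0)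
      (fun t ht => by simpa using ht.2)
      (h1.congr fun T => ?_) (h3.congr fun T => ?_) hreg.ownIdle_pos h4 hlam
    · simp only [← hS]
      rfl
    · simp only [← hP, ← hS]
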